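/- **Setting.** Let $d\ge 1$, let $\|x\|=\max_i|x_i|$ on $\mathbb Z^d$, and let $H_\omega=\varepsilon\Gamma_\phi+V_\omega(x)\delta_{x,y}$ on $\ell^2(\mathbb Z^d)$, $\varepsilon>0$. Here $\Gamma_\phi(x,y)=\phi(x-y)=\overline{\phi(y-x)}$ with $|\phi(x)|\le e^{-\gamma\log^{\rho}(\|x\|+1)}$ for some $\gamma>0$, $\rho>1$, and $\{V_\omega(x)\}_{x\in\mathbb Z^d}$ are i.i.d. random variables on a probability space $(\Omega,\mathcal F,\mathbb P)$ whose common distribution $\mu$ satisfies $\operatorname{supp}\mu\subset[-M,M]$, $M>0$. Write $\|\Gamma_\phi\|$ for the operator norm on $\ell^2(\mathbb Z^d)$, $[\,\cdot\,]$ for the integer part, and $$\frac1{\mathcal D_\lambda(\mu)}:=\inf_{t>0}\ \sup_{0<|b-a|\le t}\mu([a,b])\,|b-a|^{-\lambda}\in[0,\infty];$$ $\mu$ is Hölder continuous of order $\lambda>0$ if this quantity is finite. For $L>0$ let $B_L(x)=\{y\in\mathbb Z^d:\|y-x\|\le L\}$, let $H_{B}$ be the restriction of $H_\omega$ to $\ell^2(B)$,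 and let $G_B^E=(H_B-E)^{-1}$. Fix $\rho'\in(1,\rho)$. The cube $B_L(x)$ is *$(\kappa,E)$-good* if $\operatorname{dist}(E,\sigma(H_{B_L(x)}))\ge e^{-\log^{\rho'}L}$ and $|G^E_{B_L(x)}(x,y)|\le e^{-\kappa\log^\rho(\|x-y\|+1)}$ for all $y\in B_L(x)$ with $\|y-x\|>L^{4/5}$; otherwise it is *$(\kappa,E)$-bad*. Fix also $\kappa_0\in(0,\gamma/5]$, $\kappa_\infty\in(0,\kappa_0)$, $p>5d$ and $\alpha\in\left(\frac54,\frac{2p}{p+2d}\right)$. **Theorem 5.4 (MSA).** Let $\mu$ be Hölder continuous of order $\lambda>0$ and let $0<\beta<\mathcal D_\lambda(\mu)$. There exists $\underline L_0=\underline L_0(M,\phi,\beta,\mu,\lambda,p,d,\gamma,\rho,\rho',\alpha,\kappa_0,\kappa_\infty)>0$ such that for every $L_0\ge\underline L_0$ there are $\varepsilon_0=\varepsilon_0(\beta,\mu,L_0,d,\lambda,\phi)>0$ and $\eta=\eta(\beta,L_0,d,\lambda)>0$, all depending only on the listed quantities, with the following property. For every $E_0\in\mathbb R$ with $|E_0|\le2(\|\Gamma_\phi\|+M)$,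 all $0<\varepsilon<\varepsilon_0$, all $s\ge0$, and all $x,y\in\mathbb Z^d$ with $\|x-y\|>2L_s$, $$\mathbb P\{\exists E\in[E_0-\eta,E_0+\eta]\ \text{such that both } B_{L_s}(x)\text{ and }B_{L_s}(y)\text{ are } (\kappa_\infty,E)\text{-bad}\}\le L_s^{-2p},$$ where $L_{s+1}=[L_s^\alpha]$. -/

import Mathlib

open MeasureTheory ProbabilityTheory
open scoped ENNReal

noncomputable section

namespace LongRangeMSA

/-- The lattice `ℤ^d`; its norm is the sup norm `‖x‖ = max |x i|`. -/
abbrev Lattice (d : ℕ) : Type := Fin d → ℤ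

/-- `ℓ²(ℤ^d)`. -/
abbrev l2 (d : ℕ) : Type := lp (fun _ : Lattice d => ℂ) 2

theorem memlp_shift {d : ℕ} (k : Lattice d) (f : l2 d) :
    Memℓp (fun x : Lattice d => f (x - k)) 2 := by
  have h2 : (0 : ℝ) < (2 : ℝ≥0∞).toReal := by norm_num
  have h := (memℓp_gen_iff h2).1 (lp.memℓp f)
  exact (memℓp_gen_iff h2).2 ((Equiv.subRight k).summable_iff.2 h)

/-- The translation `(T_k f)(x) = f (x - k)` on `ℓ²(ℤ^d)`. -/
def shift {d : ℕ} (k : Lattice d) : l2 d →ₗᵢ[ℂ] l2 d where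
  toFun f := ⟨fun x => f (x - k), memlp_shift k f⟩
  map_add' _ _ := rfl
  map_smul' _ _ := rfl
  norm_map' f := by
    have h2 : (0 : ℝ) < (2 : ℝ≥0∞).toReal := by norm_num
    rw [lp.norm_eq_tsum_rpow h2, lp.norm_eq_tsum_rpow h2]
    congr 1
    exact (Equiv.subRight k).tsum_eq (fun x => ‖f x‖ ^ (2 : ℝ≥0∞).toReal)

/-- The translation invariant operator `Γ_φ = ∑ₖ φ(k) T_k` on `ℓ²(ℤ^d)`, for summable `φ`; its
matrix is `Γ_φ(x, y) = φ(x - y)`, see `hoppingOp_apply`. Its norm `‖hoppingOp φ‖` is the operator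
norm on `ℓ²(ℤ^d)`. -/
def hoppingOp {d : ℕ} (φ : Lattice d → ℂ) : l2 d →L[ℂ] l2 d :=
  ∑' k, φ k • (shift k).toContinuousLinearMap

theorem hoppingOp_apply {d : ℕ} (φ : Lattice d → ℂ) (hφ : Summable fun k => ‖φ k‖)
    (f : l2 d) (x : Lattice d) : hoppingOp φ f x = ∑' y, φ (x - y) * f y := by
  have hs : Summable fun k => φ k • (shift k).toContinuousLinearMap := by
    refine Summable.of_norm_bounded hφ fun k => ?_
    rw [norm_smul]
    exact mul_le_of_le_one_right (norm_nonneg _) (shift k).norm_toContinuousLinearMap_le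
  have h1 := (ContinuousLinearMap.apply ℂ (l2 d) f).hasSum hs.hasSum
  have h2 := (lp.evalCLM ℂ (fun _ : Lattice d => ℂ) (2 : ℝ≥0∞) x).hasSum h1
  have h3 : HasSum (fun k => φ k * f (x - k)) (hoppingOp φ f x) := h2
  rw [← h3.tsum_eq, ← (Equiv.subLeft x).tsum_eq]
  simp

/-- The matrix of `H = ε Γ_φ + v(x) δ_{x,y}` in the standard basis of `ℓ²(ℤ^d)`. -/
def hamiltonian {d : ℕ} (ε : ℝ) (φ : Lattice d → ℂ) (v : Lattice d → ℝ) :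
    Matrix (Lattice d) (Lattice d) ℂ :=
  Matrix.of fun x y => (ε : ℂ) * φ (x - y) + if x = y then (v x : ℂ) else 0

theorem finite_cube {d : ℕ} (x : Lattice d) (L : ℝ) : {y : Lattice d | ‖y - x‖ ≤ L}.Finite := by
  have h : {y : Lattice d | ‖y - x‖ ≤ L} = Metric.closedBall x L := by
    ext y; simp [dist_eq_norm]
  rw [h]
  exact (isCompact_closedBall x L).finite_of_discrete

/-- The cube `B_L(x) = {y ∈ ℤ^d : ‖y - x‖ ≤ L}`. -/
def cube {d : ℕ} (x : Lattice d) (L : ℝ) : Finset (Lattice d) := (finite_cube x L).toFinset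

theorem mem_cube {d : ℕ} {x y : Lattice d} {L : ℝ} : y ∈ cube x L ↔ ‖y - x‖ ≤ L := by
  simp [cube]

/-- The restriction `H_B` of `H` to a finite set `B`, an operator on `ℓ²(B)`. -/
def restrict {d : ℕ} (H : Matrix (Lattice d) (Lattice d) ℂ) (B : Finset (Lattice d)) :
    Matrix B B ℂ :=
  H.submatrix Subtype.val Subtype.val

/-- The Green's function `G_B^E = (H_B - E)⁻¹` (meaningful for `E ∉ σ(H_B)`). -/
def green {d : ℕ} (H : Matrix (Lattice d) (Lattice d) ℂ) (B : Finset (Lattice d)) (E : ℝ) :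
    Matrix B B ℂ :=
  (restrict H B - (E : ℂ) • (1 : Matrix B B ℂ))⁻¹

/-- `B_L(x)` is non-resonant at `E`: `dist(E, σ(H_{B_L(x)})) ≥ exp(-log^{ρ'} L)`. -/
def NonResonant {d : ℕ} (H : Matrix (Lattice d) (Lattice d) ℂ) (ρ' E : ℝ) (x : Lattice d)
    (L : ℝ) : Prop :=
  Real.exp (-(Real.log L) ^ ρ') ≤
    Metric.infDist (E : ℂ) (spectrum ℂ (restrict H (cube x L)))

/-- `B_L(x)` is `(κ, E)`-good: it is non-resonant at `E` and
`|G^E(x, y)| ≤ exp(-κ log^ρ(‖x - y‖ + 1))` for `y ∈ B_L(x)` with `‖y - x‖ > L^{4/5}`. -/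
def Good {d : ℕ} (H : Matrix (Lattice d) (Lattice d) ℂ) (ρ ρ' κ E : ℝ) (x : Lattice d)
    (L : ℝ) : Prop :=
  NonResonant H ρ' E x L ∧
    ∀ (hx : x ∈ cube x L) (y : Lattice d) (hy : y ∈ cube x L), L ^ (4 / 5 : ℝ) < ‖y - x‖ →
      ‖green H (cube x L) E ⟨x, hx⟩ ⟨y, hy⟩‖ ≤
        Real.exp (-κ * (Real.log (‖x - y‖ + 1)) ^ ρ)

/-- `(κ, E)`-bad means not `(κ, E)`-good. -/
def Bad {d : ℕ} (H : Matrix (Lattice d) (Lattice d) ℂ) (ρ ρ' κ E : ℝ) (x : Lattice d)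
    (L : ℝ) : Prop :=
  ¬ Good H ρ ρ' κ E x L

/-- `inf_{t > 0} sup_{0 < |b - a| ≤ t} μ([a, b]) |b - a|^{-lam}`, with values in `[0, ∞]`. -/
def holderCoeff (lam : ℝ) (μ : Measure ℝ) : ℝ≥0∞ :=
  ⨅ (t : ℝ) (_ : 0 < t), ⨆ (a : ℝ) (b : ℝ) (_ : 0 < |b - a| ∧ |b - a| ≤ t),
    μ (Set.Icc a b) * ENNReal.ofReal (|b - a| ^ (-lam))

/-- `μ` is Hölder continuous of order `lam`. -/
def IsHolder (lam : ℝ) (μ : Measure ℝ) : Prop := holderCoeff lam μ < ∞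

/-- `D_lam(μ) ∈ [0, ∞]`, the inverse of `holderCoeff`; it is positive iff `IsHolder lam μ`. -/
def holderD (lam : ℝ) (μ : Measure ℝ) : ℝ≥0∞ := (holderCoeff lam μ)⁻¹

/-- The scales `L_{s+1} = [L_s^α]`. -/
def scale (α L₀ : ℝ) : ℕ → ℝ
  | 0 => L₀
  | s + 1 => (⌊scale α L₀ s ^ α⌋ : ℤ)

end LongRangeMSA

end

open LongRangeMSA

namespace LongRangeMSA

open Matrix Filter Topology

/-! ### Hermitian matrices and approximate eigenvectors -/

section HermitianMatrix

variable {n : Type*} [Fintype n] [DecidableEq n]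

/-! The proof is an induction on scales, run with the scale-dependent rate `rate κ₀ κinf σ L`, which
is at most `κ₀` at the first scale and stays above `κinf`. A larger rate makes a cube easier to be
bad, so the estimate for these rates implies the one for `κinf`.

At the first scale the hopping is so weak that a cube is good as soon as its potential stays away
from the energy (`good_of_large_potential`). A bad cube therefore has a site whose potential is
close to `E₀`, which Hölder continuity makes unlikely.

The deterministic step from `l` to `L` (`eventually_good_of_subcubes`) assumes no resonant subregion
and no four separated bad `l`-cubes in the `L`-cube. Around each point one of four thin annuli is
then free of bad centers. Expanding the resolvent out of the ball bounded by that annulus ends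
either in a long hop of `φ`, or at the center of a good cube, out of which one hops again
(`exists_far_hop`). Since `exp(-κ log^ρ r)` decays subexponentially, distances need not be added up.
Because `L ≤ l²`, a number `N` of hops independent of the scale suffices: either `N` hops of length
at least `l` already give the decay, or fewer hops cover the distance and the longest of them, a
fixed fraction of it, gives almost the full decay alone (`iterate_hops`). With `m = log l`, the rate
loses `O(m^{-1} + m^{ρ'-ρ})`, which is less than the drop of order `m^{-σ}` allowed by `rate`, as `σ
< min(1, ρ - ρ')`.

For the probability, suppose two cubes are bad at a common energy. Either both contain a resonant
subregion at that energy, or one of them contains four separated bad cubes. The first event is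
controlled by a Wegner estimate that eliminates the energy through the eigenvalues of the other
region (`measure_common_resonance_le`). The second splits into two independent events of the
previous scale, so its probability is quadratic in the inductive bound (`measure_four_bad_le`). The
condition `α < 2p/(p + 2d)` lets this square absorb the number of positions. -/

theorem inner_toEuclideanLin_of_isHermitian {A : Matrix n n ℂ} (hA : A.IsHermitian)
    (ψ χ : EuclideanSpace ℂ n) :
    inner ℂ (toEuclideanLin A ψ) χ = inner ℂ ψ (toEuclideanLin A χ) :=
  isSymmetric_toEuclideanLin_iff.mpr hA ψ χ

theorem toEuclideanLin_sub_smul_one (A : Matrix n n ℂ) (E : ℂ) (ψ : EuclideanSpace ℂ n) :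
    toEuclideanLin (A - E • (1 : Matrix n n ℂ)) ψ = toEuclideanLin A ψ - E • ψ := by
  ext i
  simp [toLpLin_apply]

theorem toEuclideanLin_eigenvectorBasis {A : Matrix n n ℂ} (hA : A.IsHermitian) (k : n) :
    toEuclideanLin A (hA.eigenvectorBasis k) = (hA.eigenvalues k : ℂ) • hA.eigenvectorBasis k := by
  ext i
  have := congrFun (hA.mulVec_eigenvectorBasis k) i
  simpa [toLpLin_apply] using this

/-- A Hermitian matrix whose eigenvalues stay at distance `δ` from `E` satisfies
`δ ‖ψ‖ ≤ ‖(A - E) ψ‖`. -/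
theorem le_norm_sub_smul_of_eigenvalues {A : Matrix n n ℂ} (hA : A.IsHermitian) {δ E : ℝ}
    (hδ : 0 ≤ δ) (h : ∀ k, δ ≤ |hA.eigenvalues k - E|) (ψ : EuclideanSpace ℂ n) :
    δ * ‖ψ‖ ≤ ‖toEuclideanLin (A - (E : ℂ) • (1 : Matrix n n ℂ)) ψ‖ := by
  have key : ∀ k, inner ℂ (hA.eigenvectorBasis k)
      (toEuclideanLin (A - (E : ℂ) • (1 : Matrix n n ℂ)) ψ) =
      ((hA.eigenvalues k - E : ℝ) : ℂ) * inner ℂ (hA.eigenvectorBasis k) ψ := by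
    intro k
    rw [toEuclideanLin_sub_smul_one, inner_sub_right, ← inner_toEuclideanLin_of_isHermitian hA,
      toEuclideanLin_eigenvectorBasis, inner_smul_left, inner_smul_right]
    simp [sub_mul]
  refine le_of_sq_le_sq ?_ (norm_nonneg _)
  rw [mul_pow, ← hA.eigenvectorBasis.sum_sq_norm_inner_right ψ,
    ← hA.eigenvectorBasis.sum_sq_norm_inner_right (toEuclideanLin _ ψ), Finset.mul_sum]
  refine Finset.sum_le_sum fun k _ => ?_
  rw [key, norm_mul, mul_pow, Complex.norm_real, Real.norm_eq_abs]
  gcongr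
  exact h k

end HermitianMatrix

/-! ### Resonance as a lower bound, and Green's functions -/

variable {d : ℕ}

/-- `H_B - E` is bounded below by `δ`. -/
def LowerBounded (H : Matrix (Lattice d) (Lattice d) ℂ) (δ E : ℝ) (B : Finset (Lattice d)) : Prop :=
  ∀ ψ : EuclideanSpace ℂ B,
    δ * ‖ψ‖ ≤ ‖toEuclideanLin (restrict H B - (E : ℂ) • (1 : Matrix B B ℂ)) ψ‖

theorem LowerBounded.mono {H : Matrix (Lattice d) (Lattice d) ℂ} {δ δ' E : ℝ}
    {B : Finset (Lattice d)} (h : LowerBounded H δ E B) (hδ : δ' ≤ δ) : LowerBounded H δ' E B :=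
  fun ψ => (mul_le_mul_of_nonneg_right hδ (norm_nonneg ψ)).trans (h ψ)

theorem restrict_isHermitian {H : Matrix (Lattice d) (Lattice d) ℂ} (hH : H.IsHermitian)
    (B : Finset (Lattice d)) : (restrict H B).IsHermitian :=
  hH.submatrix _

theorem hamiltonian_isHermitian {φ : Lattice d → ℂ} (hφ : ∀ x, φ x = starRingEnd ℂ (φ (-x)))
    (ε : ℝ) (v : Lattice d → ℝ) : (hamiltonian ε φ v).IsHermitian := by
  ext x y
  simp only [hamiltonian, conjTranspose_apply, of_apply, star_add, star_mul', RCLike.star_def,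
    Complex.conj_ofReal]
  rw [hφ (x - y), neg_sub]
  congr 1
  by_cases h : x = y
  · subst h; simp
  · simp [h, Ne.symm h]

theorem LowerBounded.of_eigenvalues {H : Matrix (Lattice d) (Lattice d) ℂ} (hH : H.IsHermitian)
    {δ E : ℝ} (hδ : 0 ≤ δ) {B : Finset (Lattice d)}
    (h : ∀ k, δ ≤ |(restrict_isHermitian hH B).eigenvalues k - E|) : LowerBounded H δ E B :=
  le_norm_sub_smul_of_eigenvalues (restrict_isHermitian hH B) hδ h

theorem LowerBounded.le_dist_spectrum {H : Matrix (Lattice d) (Lattice d) ℂ} {δ E : ℝ}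
    {B : Finset (Lattice d)} (h : LowerBounded H δ E B) {z : ℂ}
    (hz : z ∈ spectrum ℂ (restrict H B)) : δ ≤ dist (E : ℂ) z := by
  rw [← spectrum_toLpLin 2, ← Module.End.hasEigenvalue_iff_mem_spectrum] at hz
  obtain ⟨ψ, hψ⟩ := hz.exists_hasEigenvector
  have h1 := h ψ
  rw [toEuclideanLin_sub_smul_one, hψ.apply_eq_smul, ← sub_smul, norm_smul] at h1
  have h2 := le_of_mul_le_mul_right h1 (norm_pos_iff.2 hψ.2)
  rwa [dist_comm, dist_eq_norm]

theorem self_mem_cube (x : Lattice d) {L : ℝ} (hL : 0 ≤ L) : x ∈ cube x L := by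
  simpa [mem_cube] using hL

/-- The spectral theorem trades the distance to the spectrum for an inequality on vectors. This form
is visibly closed in the potential, and its failure supplies an approximate eigenvector. The
hypothesis `0 ≤ L` makes the cube nonempty: `Metric.infDist` to an empty spectrum would be 0. -/
theorem nonResonant_iff {H : Matrix (Lattice d) (Lattice d) ℂ} (hH : H.IsHermitian) {ρ' E : ℝ}
    {x : Lattice d} {L : ℝ} (hL : 0 ≤ L) :
    NonResonant H ρ' E x L ↔ LowerBounded H (Real.exp (-(Real.log L) ^ ρ')) E (cube x L) := by
  have : Nonempty (cube x L) := ⟨⟨x, self_mem_cube x hL⟩⟩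
  rw [NonResonant, Metric.le_infDist (spectrum.nonempty_of_isAlgClosed_of_finiteDimensional ℂ _)]
  refine ⟨fun h => LowerBounded.of_eigenvalues hH (Real.exp_pos _).le fun k => ?_,
    fun h z hz => h.le_dist_spectrum hz⟩
  have h1 := (restrict_isHermitian hH (cube x L)).eigenvalues_mem_spectrum_real k
  have h2 := h ((spectrum.algebraMap_mem_iff ℂ).2 h1)
  rw [dist_comm, dist_eq_norm] at h2
  simpa only [Complex.coe_algebraMap, ← Complex.ofReal_sub, Complex.norm_real,
    Real.norm_eq_abs] using h2

theorem LowerBounded.isUnit_det {H : Matrix (Lattice d) (Lattice d) ℂ} {δ E : ℝ} (hδ : 0 < δ)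
    {B : Finset (Lattice d)} (h : LowerBounded H δ E B) :
    IsUnit (restrict H B - (E : ℂ) • (1 : Matrix B B ℂ)).det := by
  rw [isUnit_iff_ne_zero]
  intro h0
  obtain ⟨v, hv, hv0⟩ := exists_mulVec_eq_zero_iff.2 h0
  have h1 := h (WithLp.toLp 2 v)
  rw [toLpLin_toLp, toLin'_apply, hv0] at h1
  simp only [WithLp.toLp_zero, norm_zero] at h1
  have h2 : ‖WithLp.toLp 2 v‖ ≤ 0 := by
    by_contra! h3
    exact absurd h1 (not_le.2 (mul_pos hδ h3))
  exact hv (by simpa using norm_le_zero_iff.1 h2)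

theorem LowerBounded.norm_green_le {H : Matrix (Lattice d) (Lattice d) ℂ} {δ E : ℝ} (hδ : 0 < δ)
    {B : Finset (Lattice d)} (h : LowerBounded H δ E B) (u v : B) : ‖green H B E u v‖ ≤ δ⁻¹ := by
  have h1 := h (WithLp.toLp 2 ((green H B E).col v))
  have h2 : (restrict H B - (E : ℂ) • (1 : Matrix B B ℂ)) *ᵥ (green H B E).col v =
      Pi.single v 1 := by
    rw [← mulVec_single_one, mulVec_mulVec, green, mul_nonsing_inv _ (h.isUnit_det hδ), one_mulVec]
  rw [toLpLin_toLp, toLin'_apply, h2] at h1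
  have h3 : ‖(WithLp.toLp 2 (Pi.single v (1 : ℂ)) : EuclideanSpace ℂ B)‖ = 1 := by simp
  rw [h3] at h1
  have h4 := PiLp.norm_apply_le (WithLp.toLp 2 ((green H B E).col v)) u
  rw [inv_eq_one_div, le_div_iff₀' hδ]
  exact (mul_le_mul_of_nonneg_left h4 hδ.le).trans h1

/-- The Green's function of `H_B`, extended by zero outside of `B`. -/
noncomputable def greenExt (H : Matrix (Lattice d) (Lattice d) ℂ) (B : Finset (Lattice d)) (E : ℝ)
    (w y : Lattice d) : ℂ :=
  if h : w ∈ B ∧ y ∈ B then green H B E ⟨w, h.1⟩ ⟨y, h.2⟩ else 0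

theorem greenExt_of_mem {H : Matrix (Lattice d) (Lattice d) ℂ} {B : Finset (Lattice d)} {E : ℝ}
    {w y : Lattice d} (hw : w ∈ B) (hy : y ∈ B) :
    greenExt H B E w y = green H B E ⟨w, hw⟩ ⟨y, hy⟩ := by
  simp [greenExt, hw, hy]

theorem LowerBounded.norm_greenExt_le {H : Matrix (Lattice d) (Lattice d) ℂ} {δ E : ℝ}
    (hδ : 0 < δ) {B : Finset (Lattice d)} (h : LowerBounded H δ E B) (w y : Lattice d) :
    ‖greenExt H B E w y‖ ≤ δ⁻¹ := by
  unfold greenExt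
  split_ifs
  · exact h.norm_green_le hδ _ _
  · simpa using hδ.le

/-- The matrix `H - E`. -/
noncomputable def subEnergy (H : Matrix (Lattice d) (Lattice d) ℂ) (E : ℝ) (u v : Lattice d) : ℂ :=
  H u v - if u = v then (E : ℂ) else 0

theorem restrict_sub_apply (H : Matrix (Lattice d) (Lattice d) ℂ) (B : Finset (Lattice d)) (E : ℝ)
    (u v : B) : (restrict H B - (E : ℂ) • (1 : Matrix B B ℂ)) u v = subEnergy H E u v := by
  rw [Matrix.sub_apply, Matrix.smul_apply, Matrix.one_apply, subEnergy]
  by_cases h : u = v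
  · simp [h, restrict]
  · rw [if_neg h, if_neg (fun h' => h (Subtype.ext h'))]
    simp [restrict]

theorem sum_subEnergy_mul_greenExt {H : Matrix (Lattice d) (Lattice d) ℂ} {B : Finset (Lattice d)}
    {E : ℝ} (hdet : IsUnit (restrict H B - (E : ℂ) • (1 : Matrix B B ℂ)).det) {u y : Lattice d}
    (hu : u ∈ B) (hy : y ∈ B) :
    ∑ v ∈ B, subEnergy H E u v * greenExt H B E v y = if u = y then 1 else 0 := by
  have h := congrFun (congrFun (mul_nonsing_inv _ hdet) ⟨u, hu⟩) ⟨y, hy⟩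
  rw [Matrix.mul_apply, Matrix.one_apply] at h
  simp only [Subtype.mk.injEq] at h
  rw [← h, ← Finset.sum_coe_sort B]
  refine Finset.sum_congr rfl fun v _ => ?_
  rw [restrict_sub_apply, greenExt_of_mem v.2 hy]
  rfl

theorem sum_greenExt_mul_subEnergy {H : Matrix (Lattice d) (Lattice d) ℂ} {B : Finset (Lattice d)}
    {E : ℝ} (hdet : IsUnit (restrict H B - (E : ℂ) • (1 : Matrix B B ℂ)).det) {w v : Lattice d}
    (hw : w ∈ B) (hv : v ∈ B) :
    ∑ u ∈ B, greenExt H B E w u * subEnergy H E u v = if w = v then 1 else 0 := by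
  have h := congrFun (congrFun (nonsing_inv_mul _ hdet) ⟨w, hw⟩) ⟨v, hv⟩
  rw [Matrix.mul_apply, Matrix.one_apply] at h
  simp only [Subtype.mk.injEq] at h
  rw [← h, ← Finset.sum_coe_sort B]
  refine Finset.sum_congr rfl fun u _ => ?_
  rw [restrict_sub_apply, greenExt_of_mem hw u.2]
  rfl

/-! ### Resolvent expansion and its iteration -/

/-- The geometric resolvent identity. -/
theorem greenExt_eq_neg_sum {H : Matrix (Lattice d) (Lattice d) ℂ} {Λ B : Finset (Lattice d)}
    {E : ℝ} (hΛB : Λ ⊆ B) (hΛ : IsUnit (restrict H Λ - (E : ℂ) • (1 : Matrix Λ Λ ℂ)).det)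
    (hB : IsUnit (restrict H B - (E : ℂ) • (1 : Matrix B B ℂ)).det) {w y : Lattice d}
    (hw : w ∈ Λ) (hy : y ∈ B) (hyΛ : y ∉ Λ) :
    greenExt H B E w y =
      -∑ u ∈ Λ, ∑ v ∈ B \ Λ, greenExt H Λ E w u * subEnergy H E u v * greenExt H B E v y := by
  -- Row `u` of `(H_B - E) G_B = 1` has right-hand side 0 at `y`, as `y ∉ Λ`. The sum over `Λ` can
  -- thus be exchanged for the boundary sum.
  have h1 : ∀ u ∈ Λ, ∑ v ∈ B \ Λ, subEnergy H E u v * greenExt H B E v y =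
      -∑ v ∈ Λ, subEnergy H E u v * greenExt H B E v y := by
    intro u hu
    have h := sum_subEnergy_mul_greenExt hB (hΛB hu) hy
    rw [if_neg (fun h' : u = y => hyΛ (h' ▸ hu)), ← Finset.sum_sdiff hΛB] at h
    exact eq_neg_of_add_eq_zero_left h
  calc greenExt H B E w y = ∑ v ∈ Λ, (if w = v then 1 else 0) * greenExt H B E v y := by
        simp [hw]
    _ = ∑ v ∈ Λ, ∑ u ∈ Λ, greenExt H Λ E w u * (subEnergy H E u v * greenExt H B E v y) := by
        refine Finset.sum_congr rfl fun v hv => ?_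
        rw [← sum_greenExt_mul_subEnergy hΛ hw hv, Finset.sum_mul]
        simp only [mul_assoc]
    _ = _ := by
        rw [Finset.sum_comm, ← Finset.sum_neg_distrib]
        refine Finset.sum_congr rfl fun u hu => ?_
        simp only [mul_assoc]
        rw [← Finset.mul_sum, ← Finset.mul_sum, h1 u hu, mul_neg, neg_neg]

theorem norm_subEnergy_hamiltonian_le {φ : Lattice d → ℂ} {ε : ℝ} (hε : 0 ≤ ε) (hε1 : ε ≤ 1)
    (V : Lattice d → ℝ) (E : ℝ) {u v : Lattice d} (huv : u ≠ v) :
    ‖subEnergy (hamiltonian ε φ V) E u v‖ ≤ ‖φ (u - v)‖ := by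
  simp only [subEnergy, hamiltonian, of_apply, if_neg huv, add_zero, sub_zero, norm_mul,
    Complex.norm_real, Real.norm_eq_abs, abs_of_nonneg hε]
  exact mul_le_of_le_one_left (norm_nonneg _) hε1

/-- One step of the resolvent expansion out of `Λ`, bounded by its largest term. -/
theorem exists_hop {φ : Lattice d → ℂ} {ε : ℝ} (hε : 0 ≤ ε) (hε1 : ε ≤ 1) (V : Lattice d → ℝ)
    {Λ B : Finset (Lattice d)} {E δ₁ δ₂ : ℝ} (hδ₁ : 0 < δ₁) (hδ₂ : 0 < δ₂) (hΛB : Λ ⊆ B)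
    (hΛ : LowerBounded (hamiltonian ε φ V) δ₁ E Λ) (hB : LowerBounded (hamiltonian ε φ V) δ₂ E B)
    {w y : Lattice d} (hw : w ∈ Λ) (hy : y ∈ B) (hyΛ : y ∉ Λ) :
    ∃ u ∈ Λ, ∃ v ∈ B \ Λ, ‖greenExt (hamiltonian ε φ V) B E w y‖ ≤ (B.card : ℝ) ^ 2 *
      (‖greenExt (hamiltonian ε φ V) Λ E w u‖ * ‖φ (u - v)‖ *
        ‖greenExt (hamiltonian ε φ V) B E v y‖) := by
  set H := hamiltonian ε φ V
  let F : Lattice d × Lattice d → ℝ := fun q =>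
    ‖greenExt H Λ E w q.1‖ * ‖φ (q.1 - q.2)‖ * ‖greenExt H B E q.2 y‖
  obtain ⟨⟨u, v⟩, huv, hmax⟩ := Finset.exists_max_image (Λ ×ˢ (B \ Λ)) F
    ⟨(w, y), by simp [hw, hy, hyΛ]⟩
  rw [Finset.mem_product] at huv
  refine ⟨u, huv.1, v, huv.2, ?_⟩
  rw [greenExt_eq_neg_sum hΛB (hΛ.isUnit_det hδ₁) (hB.isUnit_det hδ₂) hw hy hyΛ, norm_neg,
    ← Finset.sum_product']
  refine (norm_sum_le _ _).trans ?_
  have hterm : ∀ q ∈ Λ ×ˢ (B \ Λ),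
      ‖greenExt H Λ E w q.1 * subEnergy H E q.1 q.2 * greenExt H B E q.2 y‖ ≤ F (u, v) := by
    intro q hq
    refine le_trans ?_ (hmax q hq)
    rw [Finset.mem_product, Finset.mem_sdiff] at hq
    rw [norm_mul, norm_mul]
    have := norm_subEnergy_hamiltonian_le (φ := φ) hε hε1 V E
      (fun h : q.1 = q.2 => hq.2.2 (h ▸ hq.1))
    simp only [F]
    gcongr
  refine (Finset.sum_le_card_nsmul _ _ _ hterm).trans ?_
  rw [nsmul_eq_mul, Finset.card_product, Nat.cast_mul, sq]
  have hF : 0 ≤ F (u, v) := by positivity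
  refine mul_le_mul_of_nonneg_right ?_ hF
  gcongr
  exact Finset.sdiff_subset

/-- Iteration of a family of hops of lengths at least `l` which gain a factor `f a` at the
price of a distance `c * a`. -/
theorem iterate_hops {ι : Type*} {g R : ι → ℝ} {f : ℝ → ℝ} {A r₀ l c : ℝ} (hg : ∀ w, 0 ≤ g w)
    (hgA : ∀ w, g w ≤ A) (hc : 0 ≤ c) (hl : 0 ≤ l) (hf0 : ∀ a, 0 ≤ f a)
    (hf : AntitoneOn f (Set.Ici l)) (hf1 : f l ≤ 1)
    (hop : ∀ w, r₀ < R w → ∃ v a, l ≤ a ∧ R w ≤ R v + c * a ∧ g w ≤ f a * g v) (n : ℕ) (w : ι) :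
    g w ≤ A * f l ^ n ∨ R w ≤ r₀ ∨ ∃ a, l ≤ a ∧ R w ≤ r₀ + c * n * a ∧ g w ≤ A * f a := by
  have hA : 0 ≤ A := (hg w).trans (hgA w)
  have hfl : ∀ a, l ≤ a → f a ≤ f l := fun a ha => hf (Set.self_mem_Ici) ha ha
  induction n generalizing w with
  | zero => exact Or.inl (by simpa using hgA w)
  | succ n ih =>
    by_cases hR : R w ≤ r₀
    · exact Or.inr (Or.inl hR)
    obtain ⟨v, a, hla, hRv, hgv⟩ := hop w (not_le.1 hR)
    have hfa1 : f a ≤ 1 := (hfl a hla).trans hf1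
    have ha : 0 ≤ a := hl.trans hla
    rcases ih v with h | h | ⟨b, hlb, hRb, hgb⟩
    · left
      calc g w ≤ f a * g v := hgv
        _ ≤ f l * (A * f l ^ n) := mul_le_mul (hfl a hla) h (hg v) (hf0 l)
        _ = A * f l ^ (n + 1) := by ring
    -- The walk stops right after this hop, which is the longest one so far; what follows is bounded
    -- by `A`.
    · refine Or.inr (Or.inr ⟨a, hla, ?_, ?_⟩)
      · push_cast
        have : 0 ≤ c * n * a := by positivity
        linarith
      · rw [mul_comm]
        exact hgv.trans (mul_le_mul_of_nonneg_left (hgA v) (hf0 a))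
    -- Only the decay of the longer hop is kept; the other factor is at most 1.
    · refine Or.inr (Or.inr ⟨max a b, hla.trans (le_max_left _ _), ?_, ?_⟩)
      · push_cast
        have h1 : c * n * b ≤ c * n * max a b := by gcongr; exact le_max_right _ _
        have h2 : c * a ≤ c * max a b := by gcongr; exact le_max_left _ _
        linarith
      · have hb1 : f b ≤ 1 := (hfl b hlb).trans hf1
        have h1 : g w ≤ f a * (A * f b) := hgv.trans (mul_le_mul_of_nonneg_left hgb (hf0 a))
        rcases le_total a b with hab | hab
        · rw [max_eq_right hab]
          exact h1.trans (mul_le_of_le_one_left (mul_nonneg hA (hf0 b)) hfa1)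
        · rw [max_eq_left hab]
          refine h1.trans ?_
          rw [mul_left_comm]
          exact mul_le_mul_of_nonneg_left (mul_le_of_le_one_right (hf0 a) hb1) hA

/-- The decay factor `exp(-κ log^ρ(a / 2))` of a hop of length `a`. -/
noncomputable def hopDecay (κ ρ a : ℝ) : ℝ := Real.exp (-κ * (Real.log (a / 2)) ^ ρ)

theorem hopDecay_pos (κ ρ a : ℝ) : 0 < hopDecay κ ρ a := Real.exp_pos _

theorem hopDecay_antitoneOn {κ ρ : ℝ} (hκ : 0 ≤ κ) (hρ : 0 ≤ ρ) :
    AntitoneOn (hopDecay κ ρ) (Set.Ici 2) := by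
  intro a ha b hb hab
  simp only [Set.mem_Ici] at ha hb
  unfold hopDecay
  have h0 : 0 ≤ Real.log (a / 2) := Real.log_nonneg (by linarith)
  have h1 : Real.log (a / 2) ≤ Real.log (b / 2) := Real.log_le_log (by linarith) (by linarith)
  have h2 := mul_le_mul_of_nonneg_left (Real.rpow_le_rpow h0 h1 hρ) hκ
  exact Real.exp_le_exp.2 (by linarith)

/-- A displacement of total length `a` made of two pieces has a piece of length at least `a / 2`.
Both the decay of `φ` and that of a good cube's Green's function are converted by this bound. -/
theorem exp_neg_mul_log_rpow_le_hopDecay {κ γ ρ a r : ℝ} (hκ : 0 ≤ κ) (hκγ : κ ≤ γ) (hρ : 0 ≤ ρ)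
    (ha : 2 ≤ a) (har : a / 2 ≤ r + 1) :
    Real.exp (-γ * (Real.log (r + 1)) ^ ρ) ≤ hopDecay κ ρ a := by
  unfold hopDecay
  have h0 : 0 ≤ Real.log (a / 2) := Real.log_nonneg (by linarith)
  have h1 : Real.log (a / 2) ≤ Real.log (r + 1) := Real.log_le_log (by linarith) har
  have h2 := Real.rpow_le_rpow h0 h1 hρ
  have h3 := mul_le_mul hκγ h2 (Real.rpow_nonneg h0 _) (hκ.trans hκγ)
  exact Real.exp_le_exp.2 (by linarith)

theorem norm_le_one_of_decay {φ : Lattice d → ℂ} {γ ρ : ℝ} (hγ : 0 ≤ γ)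
    (hφ : ∀ x, ‖φ x‖ ≤ Real.exp (-γ * (Real.log (‖x‖ + 1)) ^ ρ)) (x : Lattice d) : ‖φ x‖ ≤ 1 := by
  refine (hφ x).trans (Real.exp_le_one_iff.2 ?_)
  have : 0 ≤ (Real.log (‖x‖ + 1)) ^ ρ :=
    Real.rpow_nonneg (Real.log_nonneg (by linarith [norm_nonneg x])) _
  nlinarith

/-- The hop out of a good cube. -/
theorem exists_good_hop {φ : Lattice d → ℂ} (hsym : ∀ x, φ x = starRingEnd ℂ (φ (-x)))
    {γ ρ ρ' κ : ℝ} (hκ : 0 ≤ κ) (hκγ : κ ≤ γ) (hρ : 0 ≤ ρ)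
    (hφ : ∀ x, ‖φ x‖ ≤ Real.exp (-γ * (Real.log (‖x‖ + 1)) ^ ρ))
    {ε : ℝ} (hε : 0 ≤ ε) (hε1 : ε ≤ 1) {V : Lattice d → ℝ} {E l δ : ℝ} {B : Finset (Lattice d)}
    (hl : 2 ≤ l) (hl' : l ^ (4 / 5 : ℝ) ≤ l / 2) (hδ : 0 < δ) (hδ1 : δ ≤ 1)
    (hδl : δ ≤ Real.exp (-(Real.log l) ^ ρ'))
    (hB : LowerBounded (hamiltonian ε φ V) δ E B) {w y : Lattice d} (hwB : cube w l ⊆ B)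
    (hy : y ∈ B) (hyw : y ∉ cube w l) (hgood : Good (hamiltonian ε φ V) ρ ρ' κ E w l) :
    ∃ v, l < ‖v - w‖ ∧ ‖greenExt (hamiltonian ε φ V) B E w y‖ ≤
      ((B.card : ℝ) ^ 2 * δ⁻¹) * hopDecay κ ρ ‖v - w‖ *
        ‖greenExt (hamiltonian ε φ V) B E v y‖ := by
  set H := hamiltonian ε φ V
  have hl0 : 0 ≤ l := by linarith
  have hΛ : LowerBounded H δ E (cube w l) :=
    ((nonResonant_iff (hamiltonian_isHermitian hsym ε V) hl0).1 hgood.1).mono hδl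
  have hw : w ∈ cube w l := self_mem_cube w hl0
  obtain ⟨u, hu, v, hv, hle⟩ := exists_hop hε hε1 V hδ hδ hwB hΛ hB hw hy hyw
  rw [Finset.mem_sdiff, mem_cube, not_le] at hv
  refine ⟨v, hv.2, ?_⟩
  suffices h : ‖greenExt H (cube w l) E w u‖ * ‖φ (u - v)‖ ≤ δ⁻¹ * hopDecay κ ρ ‖v - w‖ by
    have h' := mul_le_mul_of_nonneg_left
      (mul_le_mul_of_nonneg_right h (norm_nonneg (greenExt H B E v y)))
      (sq_nonneg (B.card : ℝ))
    exact hle.trans (h'.trans_eq (by ring))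
  have hδinv : 1 ≤ δ⁻¹ := (one_le_inv₀ hδ).2 hδ1
  -- Either the inner leg `w → u` is at least half of the way, hence longer than `l^{4/5}` and
  -- covered by goodness, or the leg `u → v` is, and `φ` decays.
  by_cases hcase : ‖v - w‖ / 2 ≤ ‖u - w‖
  · have h1 := hgood.2 hw u hu (by linarith)
    rw [← greenExt_of_mem hw hu] at h1
    have h2 := h1.trans (exp_neg_mul_log_rpow_le_hopDecay (a := ‖v - w‖) hκ le_rfl hρ
      (by linarith) (by rw [norm_sub_rev w u]; linarith))
    calc _ ≤ hopDecay κ ρ ‖v - w‖ * 1 :=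
          mul_le_mul h2 (norm_le_one_of_decay (hκ.trans hκγ) hφ _) (norm_nonneg _)
            (hopDecay_pos _ _ _).le
      _ ≤ _ := by
          rw [mul_comm]
          exact mul_le_mul_of_nonneg_right hδinv (hopDecay_pos _ _ _).le
  · have h3 : ‖v - w‖ ≤ ‖u - v‖ + ‖u - w‖ := by
      rw [norm_sub_rev u v]
      exact norm_sub_le_norm_sub_add_norm_sub v u w
    exact mul_le_mul (hΛ.norm_greenExt_le hδ _ _)
      ((hφ _).trans (exp_neg_mul_log_rpow_le_hopDecay hκ hκγ hρ (by linarith) (by linarith)))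
      (norm_nonneg _) (by positivity)

/-- Among four thin annuli around `w` one contains no bad centers, unless there are four separated
bad centers. -/
theorem exists_annulus {Q : Lattice d → Prop} {B : Finset (Lattice d)} {l : ℝ} (hl : 0 < l)
    (hQ : ∀ z : Fin 4 → Lattice d, (∀ i, z i ∈ B) → (∀ i j, i ≠ j → 2 * l < ‖z i - z j‖) →
      ∃ i, Q (z i)) (w : Lattice d) :
    ∃ k : ℕ, 1 ≤ k ∧ k ≤ 4 ∧ ∀ v ∈ B, 10 * k * l < ‖v - w‖ → ‖v - w‖ ≤ 10 * k * l + l → Q v := by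
  by_contra! hcon
  have h : ∀ i : Fin 4, ∃ v ∈ B, 10 * ((i : ℝ) + 1) * l < ‖v - w‖ ∧
      ‖v - w‖ ≤ 10 * ((i : ℝ) + 1) * l + l ∧ ¬ Q v := by
    intro i
    have := hcon (i + 1) (by omega) (by omega)
    push_cast at this
    exact this
  choose z hzB hz1 hz2 hzQ using h
  -- Radii are spaced by `10 l` and the annuli have width `l`, so points of different annuli are
  -- more than `9 l` apart.
  have hlt : ∀ i j : Fin 4, i < j → 2 * l < ‖z i - z j‖ := by
    intro i j hij
    have h1 : ‖z j - w‖ ≤ ‖z i - z j‖ + ‖z i - w‖ := by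
      rw [norm_sub_rev (z i) (z j)]
      exact norm_sub_le_norm_sub_add_norm_sub _ _ _
    have h2 : (i : ℝ) + 1 ≤ (j : ℝ) := by exact_mod_cast hij
    have h3 : ((i : ℝ) + 1) * l ≤ (j : ℝ) * l := mul_le_mul_of_nonneg_right h2 hl.le
    linarith [hz1 j, hz2 i]
  obtain ⟨i, hi⟩ := hQ z hzB fun i j hij => by
    rcases lt_or_gt_of_ne hij with h | h
    · exact hlt i j h
    · rw [norm_sub_rev]; exact hlt j i h
  exact hzQ i hi

/-- The hop out of an arbitrary point which is far from the boundary of the cube and from `y`. -/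
theorem exists_far_hop {φ : Lattice d → ℂ} (hsym : ∀ x, φ x = starRingEnd ℂ (φ (-x)))
    {γ ρ ρ' κ : ℝ} (hκ : 0 ≤ κ) (hκγ : κ ≤ γ) (hρ : 0 ≤ ρ)
    (hφ : ∀ x, ‖φ x‖ ≤ Real.exp (-γ * (Real.log (‖x‖ + 1)) ^ ρ))
    {ε : ℝ} (hε : 0 ≤ ε) (hε1 : ε ≤ 1) {V : Lattice d → ℝ} {E l L δ : ℝ} {x : Lattice d}
    (hl : 2 ≤ l) (hl' : l ^ (4 / 5 : ℝ) ≤ l / 2) (hδ : 0 < δ) (hδ1 : δ ≤ 1)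
    (hδl : δ ≤ Real.exp (-(Real.log l) ^ ρ'))
    (hB : LowerBounded (hamiltonian ε φ V) δ E (cube x L))
    (hsub : ∀ w ∈ cube x L, ∀ k : ℕ, 1 ≤ k → k ≤ 4 →
      LowerBounded (hamiltonian ε φ V) δ E (cube w (10 * k * l) ∩ cube x L))
    (hbad : ∀ z : Fin 4 → Lattice d, (∀ i, z i ∈ cube x L) →
      (∀ i j, i ≠ j → 2 * l < ‖z i - z j‖) → ∃ i, Good (hamiltonian ε φ V) ρ ρ' κ E (z i) l)
    {w y : Lattice d} (hy : y ∈ cube x L) (hw : 100 * l < min (L - ‖w - x‖) ‖w - y‖) :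
    ∃ v a, l ≤ a ∧ min (L - ‖w - x‖) ‖w - y‖ ≤ min (L - ‖v - x‖) ‖v - y‖ + 42 * a ∧
      ‖greenExt (hamiltonian ε φ V) (cube x L) E w y‖ ≤
        ((((cube x L).card : ℝ) ^ 2 * δ⁻¹) ^ 2 * hopDecay κ ρ a) *
          ‖greenExt (hamiltonian ε φ V) (cube x L) E v y‖ := by
  set H := hamiltonian ε φ V
  set B := cube x L
  obtain ⟨A, hAdef⟩ : ∃ A : ℝ, A = (B.card : ℝ) ^ 2 * δ⁻¹ := ⟨_, rfl⟩
  rw [lt_min_iff] at hw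
  have hδinv : 1 ≤ δ⁻¹ := (one_le_inv₀ hδ).2 hδ1
  have hA : 1 ≤ A := by
    have h1 : (1 : ℝ) ≤ B.card := by exact_mod_cast Finset.card_pos.2 ⟨y, hy⟩
    rw [hAdef]
    exact one_le_mul_of_one_le_of_one_le (one_le_pow₀ h1) hδinv
  have hA0 : 0 ≤ A := zero_le_one.trans hA
  rw [← hAdef]
  have hwB : w ∈ B := mem_cube.2 (by linarith)
  have hmin : ∀ v a, ‖v - w‖ ≤ a →
      min (L - ‖w - x‖) ‖w - y‖ ≤ min (L - ‖v - x‖) ‖v - y‖ + a := by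
    intro v a hva
    have h1 : ‖v - x‖ ≤ ‖v - w‖ + ‖w - x‖ := norm_sub_le_norm_sub_add_norm_sub _ _ _
    have h2 : ‖w - y‖ ≤ ‖v - w‖ + ‖v - y‖ := by
      rw [norm_sub_rev v w]; exact norm_sub_le_norm_sub_add_norm_sub _ _ _
    rw [← min_add_add_right]
    exact le_min ((min_le_left _ _).trans (by linarith)) ((min_le_right _ _).trans (by linarith))
  obtain ⟨k, hk1, hk4, hann⟩ := exists_annulus (Q := fun z => Good H ρ ρ' κ E z l)
    (by linarith) hbad w
  have hk4' : (k : ℝ) ≤ 4 := by exact_mod_cast hk4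
  have hkl : (k : ℝ) * l ≤ 4 * l := mul_le_mul_of_nonneg_right hk4' (by linarith)
  have hcubeB : cube w (10 * k * l) ⊆ B := by
    intro v hv
    rw [mem_cube] at hv ⊢
    have h1 : ‖v - x‖ ≤ ‖v - w‖ + ‖w - x‖ := norm_sub_le_norm_sub_add_norm_sub _ _ _
    linarith
  have hΛ : LowerBounded H δ E (cube w (10 * k * l)) := by
    have := hsub w hwB k hk1 hk4
    rwa [Finset.inter_eq_left.2 hcubeB] at this
  have hyΛ : y ∉ cube w (10 * k * l) := by
    rw [mem_cube, norm_sub_rev]; linarith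
  obtain ⟨u, hu, v, hv, hle⟩ := exists_hop hε hε1 V hδ hδ hcubeB hΛ hB
    (self_mem_cube w (by positivity)) hy hyΛ
  rw [Finset.mem_sdiff] at hv
  rw [mem_cube] at hu
  have hvw : ‖v - w‖ ≤ ‖u - v‖ + ‖u - w‖ := by
    rw [norm_sub_rev u v]
    exact norm_sub_le_norm_sub_add_norm_sub v u w
  have hle2 : ‖greenExt H B E w y‖ ≤ A * (‖φ (u - v)‖ * ‖greenExt H B E v y‖) := by
    refine hle.trans ?_
    rw [show A * (‖φ (u - v)‖ * ‖greenExt H B E v y‖) =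
      (B.card : ℝ) ^ 2 * (δ⁻¹ * ‖φ (u - v)‖ * ‖greenExt H B E v y‖) by rw [hAdef]; ring]
    refine mul_le_mul_of_nonneg_left ?_ (sq_nonneg _)
    gcongr
    exact hΛ.norm_greenExt_le hδ _ _
  -- A leg longer than `l` gains from `φ`, and `‖v - w‖ ≤ 40 l + a ≤ 41 a`. Otherwise `v` lies in
  -- the clean annulus, within `41 l` of `w`, and the hop out of the good cube around `v` makes the
  -- total at most `42 a`. Starting more than `100 l` from the boundary and from `y` leaves room for
  -- both.
  by_cases hcase : l < ‖u - v‖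
  · refine ⟨v, ‖u - v‖, hcase.le, hmin _ _ (by linarith), hle2.trans ?_⟩
    have h1 := (hφ _).trans (exp_neg_mul_log_rpow_le_hopDecay (r := ‖u - v‖) (a := ‖u - v‖)
      hκ hκγ hρ (by linarith) (by linarith))
    rw [mul_assoc (A ^ 2)]
    refine mul_le_mul (le_self_pow₀ hA two_ne_zero) ?_
      (mul_nonneg (norm_nonneg _) (norm_nonneg _)) (sq_nonneg A)
    exact mul_le_mul_of_nonneg_right h1 (norm_nonneg _)
  · have hv2 := hv.2
    rw [mem_cube, not_le] at hv2
    have hvw' : ‖v - w‖ ≤ 41 * l := by linarith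
    have hgood := hann v hv.1 hv2 (by linarith)
    have hvB : cube v l ⊆ B := by
      intro z hz
      rw [mem_cube] at hz ⊢
      have h1 : ‖z - x‖ ≤ ‖z - v‖ + ‖v - x‖ := norm_sub_le_norm_sub_add_norm_sub _ _ _
      have h2 : ‖v - x‖ ≤ ‖v - w‖ + ‖w - x‖ := norm_sub_le_norm_sub_add_norm_sub _ _ _
      linarith
    have hyv : y ∉ cube v l := by
      rw [mem_cube, norm_sub_rev]
      have h1 : ‖w - y‖ ≤ ‖w - v‖ + ‖v - y‖ := norm_sub_le_norm_sub_add_norm_sub _ _ _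
      rw [norm_sub_rev w v] at h1
      linarith
    obtain ⟨v', hv', hle'⟩ := exists_good_hop hsym hκ hκγ hρ hφ hε hε1 hl hl' hδ hδ1 hδl hB hvB hy
      hyv hgood
    rw [← hAdef] at hle'
    refine ⟨v', ‖v' - v‖, hv'.le, hmin _ _ ?_, hle2.trans ?_⟩
    · have h1 : ‖v' - w‖ ≤ ‖v' - v‖ + ‖v - w‖ := norm_sub_le_norm_sub_add_norm_sub _ _ _
      linarith
    · have h1 : ‖φ (u - v)‖ * ‖greenExt H B E v y‖ ≤ 1 * ‖greenExt H B E v y‖ :=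
        mul_le_mul_of_nonneg_right (norm_le_one_of_decay (hκ.trans hκγ) hφ _) (norm_nonneg _)
      rw [one_mul] at h1
      calc _ ≤ A * (A * hopDecay κ ρ ‖v' - v‖ * ‖greenExt H B E v' y‖) :=
            mul_le_mul_of_nonneg_left (h1.trans hle') hA0
        _ = _ := by ring

/-- The Green's function of a cube without resonant subcubes and without four separated
bad subcubes. -/
theorem greenExt_decay_alternative {φ : Lattice d → ℂ}
    (hsym : ∀ x, φ x = starRingEnd ℂ (φ (-x)))
    {γ ρ ρ' κ : ℝ} (hκ : 0 ≤ κ) (hκγ : κ ≤ γ) (hρ : 0 ≤ ρ)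
    (hφ : ∀ x, ‖φ x‖ ≤ Real.exp (-γ * (Real.log (‖x‖ + 1)) ^ ρ))
    {ε : ℝ} (hε : 0 ≤ ε) (hε1 : ε ≤ 1) {V : Lattice d → ℝ} {E l L δ A : ℝ} {x : Lattice d}
    (hl : 2 ≤ l) (hl' : l ^ (4 / 5 : ℝ) ≤ l / 2) (hδ : 0 < δ) (hδ1 : δ ≤ 1)
    (hδl : δ ≤ Real.exp (-(Real.log l) ^ ρ'))
    (hA : ((cube x L).card : ℝ) ^ 2 * δ⁻¹ ≤ A) (hAl : A ^ 2 * hopDecay κ ρ l ≤ 1)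
    (hB : LowerBounded (hamiltonian ε φ V) δ E (cube x L))
    (hsub : ∀ w ∈ cube x L, ∀ k : ℕ, 1 ≤ k → k ≤ 4 →
      LowerBounded (hamiltonian ε φ V) δ E (cube w (10 * k * l) ∩ cube x L))
    (hbad : ∀ z : Fin 4 → Lattice d, (∀ i, z i ∈ cube x L) →
      (∀ i j, i ≠ j → 2 * l < ‖z i - z j‖) → ∃ i, Good (hamiltonian ε φ V) ρ ρ' κ E (z i) l)
    {y : Lattice d} (hy : y ∈ cube x L) (hxy : 100 * l < ‖y - x‖) (n : ℕ) :
    ‖greenExt (hamiltonian ε φ V) (cube x L) E x y‖ ≤ A * (A ^ 2 * hopDecay κ ρ l) ^ n ∨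
    ∃ a, l ≤ a ∧ ‖y - x‖ ≤ 100 * l + 42 * n * a ∧
      ‖greenExt (hamiltonian ε φ V) (cube x L) E x y‖ ≤ A * (A ^ 2 * hopDecay κ ρ a) := by
  have hcard : (1 : ℝ) ≤ (cube x L).card := by exact_mod_cast Finset.card_pos.2 ⟨y, hy⟩
  have hδA : δ⁻¹ ≤ A :=
    (le_mul_of_one_le_left (by positivity) (one_le_pow₀ hcard)).trans hA
  have hanti : AntitoneOn (fun a => A ^ 2 * hopDecay κ ρ a) (Set.Ici l) := fun a ha b hb hab =>
    mul_le_mul_of_nonneg_left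
      (hopDecay_antitoneOn hκ hρ (hl.trans ha) (hl.trans hb) hab) (sq_nonneg A)
  -- The quantity that the hops use up is the smaller of the distances to the boundary and to `y`;
  -- at the center it is `‖y - x‖`.
  have hyx : min (L - ‖x - x‖) ‖x - y‖ = ‖y - x‖ := by
    rw [sub_self, norm_zero, sub_zero, norm_sub_rev]
    exact min_eq_right (mem_cube.1 hy)
  have key := iterate_hops (g := fun w => ‖greenExt (hamiltonian ε φ V) (cube x L) E w y‖)
    (R := fun w => min (L - ‖w - x‖) ‖w - y‖) (f := fun a => A ^ 2 * hopDecay κ ρ a)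
    (A := A) (r₀ := 100 * l) (l := l) (c := 42) (fun w => norm_nonneg _)
    (fun w => (hB.norm_greenExt_le hδ w y).trans hδA) (by norm_num) (by linarith)
    (fun a => mul_nonneg (sq_nonneg A) (hopDecay_pos _ _ _).le) hanti hAl
    (fun w hw => by
      obtain ⟨v, a, h1, h2, h3⟩ := exists_far_hop hsym hκ hκγ hρ hφ hε hε1 hl hl' hδ hδ1 hδl hB hsub
        hbad hy hw
      refine ⟨v, a, h1, h2, h3.trans (mul_le_mul_of_nonneg_right ?_ (norm_nonneg _))⟩
      exact mul_le_mul_of_nonneg_right (pow_le_pow_left₀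
        (mul_nonneg (sq_nonneg _) (inv_nonneg.2 hδ.le)) hA 2) (hopDecay_pos κ ρ a).le) n x
  simp only [hyx] at key
  rcases key with h | h | h
  · exact Or.inl h
  · linarith
  · exact Or.inr h

/-! ### Concentration of the single-site law and rank-one perturbations -/

theorem exists_measure_Icc_le {lam β : ℝ} (hβ : 0 < β) {μ : Measure ℝ}
    (h : ENNReal.ofReal β < holderD lam μ) :
    ∃ t > 0, ∀ a r : ℝ, 0 < r → r ≤ t →
      μ (Set.Icc a (a + r)) ≤ ENNReal.ofReal (β⁻¹ * r ^ lam) := by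
  have h1 : holderCoeff lam μ < ENNReal.ofReal β⁻¹ := by
    rw [ENNReal.ofReal_inv_of_pos hβ]
    exact ENNReal.lt_inv_iff_lt_inv.1 h
  simp only [holderCoeff, iInf_lt_iff] at h1
  obtain ⟨t, ht, h1⟩ := h1
  refine ⟨t, ht, fun a r hr hrt => ?_⟩
  have h2 : μ (Set.Icc a (a + r)) * ENNReal.ofReal (r ^ (-lam)) ≤ ENNReal.ofReal β⁻¹ := by
    refine le_trans ?_ h1.le
    have habs : |a + r - a| = r := by rw [add_sub_cancel_left, abs_of_pos hr]
    refine le_iSup_of_le a (le_iSup_of_le (a + r) (le_iSup_of_le ?_ ?_))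
    · rw [habs]; exact ⟨hr, hrt⟩
    · rw [habs]
  have hpos : 0 < r ^ lam := Real.rpow_pos_of_pos hr _
  rw [Real.rpow_neg hr.le, ENNReal.ofReal_inv_of_pos hpos, ← div_eq_mul_inv,
    ENNReal.div_le_iff (by simpa using hpos) ENNReal.ofReal_ne_top] at h2
  rwa [ENNReal.ofReal_mul (inv_nonneg.2 hβ.le)]

/-- A set of diameter at most `r` lies in the interval of length `r` starting at its infimum.
Measurability of the set is not needed. -/
theorem measure_le_of_forall_abs_sub_le {μ : Measure ℝ} {r : ℝ} {s : ℝ≥0∞}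
    (hμ : ∀ a, μ (Set.Icc a (a + r)) ≤ s) {T : Set ℝ}
    (hT : ∀ v ∈ T, ∀ v' ∈ T, |v - v'| ≤ r) : μ T ≤ s := by
  rcases T.eq_empty_or_nonempty with rfl | ⟨v₀, hv₀⟩
  · simp
  have hbdd : BddBelow T := ⟨v₀ - r, fun v hv => by
    have := abs_le.1 (hT v hv v₀ hv₀); linarith⟩
  refine (measure_mono fun v hv => ?_).trans (hμ (sInf T))
  refine ⟨csInf_le hbdd hv, ?_⟩
  have : v - r ≤ sInf T := le_csInf ⟨v₀, hv₀⟩ fun v' hv' => by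
    have := abs_le.1 (hT v hv v' hv'); linarith
  linarith

/-- Two Hermitian matrices differing only in one diagonal entry, with approximate eigenvectors for
the same energy that are large at that entry, are close. -/
theorem abs_le_of_approx_eigenvectors {n : Type*} [Fintype n] [DecidableEq n] {A A' : Matrix n n ℂ}
    (hA' : A'.IsHermitian) {i : n} {t E η N : ℝ} (hN : 0 < N)
    (hAA' : A - A' = Matrix.single i i (t : ℂ)) {ψ ψ' : EuclideanSpace ℂ n} (hψ : ‖ψ‖ = 1)
    (hψ' : ‖ψ'‖ = 1) (hi : N⁻¹ ≤ ‖ψ i‖ ^ 2) (hi' : N⁻¹ ≤ ‖ψ' i‖ ^ 2)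
    (h : ‖toEuclideanLin (A - (E : ℂ) • (1 : Matrix n n ℂ)) ψ‖ ≤ η)
    (h' : ‖toEuclideanLin (A' - (E : ℂ) • (1 : Matrix n n ℂ)) ψ'‖ ≤ η) : |t| ≤ 2 * η * N := by
  have hA : toEuclideanLin A ψ =
      toEuclideanLin A' ψ + EuclideanSpace.single i ((t : ℂ) * ψ i) := by
    rw [← sub_eq_iff_eq_add', ← LinearMap.sub_apply, ← map_sub, hAA']
    ext j
    simp [toLpLin_apply, Matrix.single_mulVec, Function.update_apply]
  -- Moving `A' - E` across the inner product cancels everything except the rank-one difference,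
  -- evaluated at the site `i`.
  have key : inner ℂ ψ' (toEuclideanLin (A - (E : ℂ) • (1 : Matrix n n ℂ)) ψ) -
      inner ℂ (toEuclideanLin (A' - (E : ℂ) • (1 : Matrix n n ℂ)) ψ') ψ =
      (t : ℂ) * ψ i * starRingEnd ℂ (ψ' i) := by
    rw [toEuclideanLin_sub_smul_one, toEuclideanLin_sub_smul_one, inner_sub_left, inner_sub_right,
      inner_toEuclideanLin_of_isHermitian hA', hA, inner_add_right, inner_smul_left,
      inner_smul_right, EuclideanSpace.inner_single_right]
    simp
  have h1 : ‖(t : ℂ) * ψ i * starRingEnd ℂ (ψ' i)‖ ≤ 2 * η := by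
    rw [← key]
    refine (norm_sub_le _ _).trans ?_
    have h2 := norm_inner_le_norm (𝕜 := ℂ) ψ' (toEuclideanLin (A - (E : ℂ) • 1) ψ)
    have h3 := norm_inner_le_norm (𝕜 := ℂ) (toEuclideanLin (A' - (E : ℂ) • 1) ψ') ψ
    rw [hψ', one_mul] at h2
    rw [hψ, mul_one] at h3
    linarith
  rw [norm_mul, norm_mul, Complex.norm_real, Real.norm_eq_abs, RCLike.norm_conj, mul_assoc] at h1
  have h4 : N⁻¹ ≤ ‖ψ i‖ * ‖ψ' i‖ := by
    refine le_of_sq_le_sq ?_ (by positivity)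
    rw [mul_pow, sq]
    exact mul_le_mul hi hi' (by positivity) (by positivity)
  have h5 : |t| * N⁻¹ ≤ 2 * η := (mul_le_mul_of_nonneg_left h4 (abs_nonneg t)).trans h1
  rwa [← div_eq_mul_inv, div_le_iff₀ hN] at h5

/-! ### Locality and topology of the events -/

theorem restrict_hamiltonian_congr {ε : ℝ} {φ : Lattice d → ℂ} {B : Finset (Lattice d)}
    {v v' : Lattice d → ℝ} (h : ∀ z ∈ B, v z = v' z) :
    restrict (hamiltonian ε φ v) B = restrict (hamiltonian ε φ v') B := by
  ext a b
  simp [restrict, hamiltonian, h a a.2]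

theorem lowerBounded_congr {H H' : Matrix (Lattice d) (Lattice d) ℂ} {δ E : ℝ}
    {B : Finset (Lattice d)} (h : restrict H B = restrict H' B) :
    LowerBounded H δ E B ↔ LowerBounded H' δ E B := by
  simp only [LowerBounded, h]

theorem good_congr {H H' : Matrix (Lattice d) (Lattice d) ℂ} {ρ ρ' κ E L : ℝ} {x : Lattice d}
    (h : restrict H (cube x L) = restrict H' (cube x L)) :
    Good H ρ ρ' κ E x L ↔ Good H' ρ ρ' κ E x L := by
  simp only [Good, NonResonant, green, h]

theorem continuous_restrict_hamiltonian (ε : ℝ) (φ : Lattice d → ℂ) (B : Finset (Lattice d))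
    (E : ℝ) : Continuous fun v : Lattice d → ℝ =>
      restrict (hamiltonian ε φ v) B - (E : ℂ) • (1 : Matrix B B ℂ) := by
  refine Continuous.sub ?_ continuous_const
  refine continuous_matrix fun a b => ?_
  simp only [restrict, hamiltonian, submatrix_apply, of_apply]
  split_ifs
  · fun_prop
  · fun_prop

theorem continuous_norm_restrict_hamiltonian (ε : ℝ) (φ : Lattice d → ℂ) (B : Finset (Lattice d))
    (E : ℝ) (ψ : EuclideanSpace ℂ B) : Continuous fun v : Lattice d → ℝ =>
      ‖toEuclideanLin (restrict (hamiltonian ε φ v) B - (E : ℂ) • (1 : Matrix B B ℂ)) ψ‖ := by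
  simp only [toLpLin_apply]
  exact ((PiLp.continuous_toLp 2 _).comp
    ((continuous_restrict_hamiltonian ε φ B E).matrix_mulVec continuous_const)).norm

theorem isClosed_lowerBounded (ε : ℝ) (φ : Lattice d → ℂ) (δ E : ℝ) (B : Finset (Lattice d)) :
    IsClosed {v : Lattice d → ℝ | LowerBounded (hamiltonian ε φ v) δ E B} := by
  simp only [LowerBounded, Set.ofPred_forall]
  exact isClosed_iInter fun ψ =>
    isClosed_le continuous_const (continuous_norm_restrict_hamiltonian ε φ B E ψ)

/-- By Cramer's rule the bound on the Green's function compares the norms of an adjugate entry and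
of the determinant, both continuous in the potential. Non-resonance makes the determinant nonzero,
so clearing the denominator is harmless. -/
theorem isClosed_good {φ : Lattice d → ℂ} (hsym : ∀ x, φ x = starRingEnd ℂ (φ (-x)))
    (ε ρ ρ' κ E : ℝ) (x : Lattice d) {L : ℝ} (hL : 0 ≤ L) :
    IsClosed {v : Lattice d → ℝ | Good (hamiltonian ε φ v) ρ ρ' κ E x L} := by
  let M : (Lattice d → ℝ) → Matrix (cube x L) (cube x L) ℂ := fun v =>
    restrict (hamiltonian ε φ v) (cube x L) - (E : ℂ) • (1 : Matrix (cube x L) (cube x L) ℂ)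
  have hM : Continuous M := continuous_restrict_hamiltonian ε φ (cube x L) E
  have heq : {v : Lattice d → ℝ | Good (hamiltonian ε φ v) ρ ρ' κ E x L} =
      {v | LowerBounded (hamiltonian ε φ v) (Real.exp (-(Real.log L) ^ ρ')) E (cube x L)} ∩
      ⋂ (y : cube x L) (_ : L ^ (4 / 5 : ℝ) < ‖(y : Lattice d) - x‖),
        {v | ‖(M v).adjugate ⟨x, self_mem_cube x hL⟩ y‖ ≤
          ‖(M v).det‖ * Real.exp (-κ * (Real.log (‖x - (y : Lattice d)‖ + 1)) ^ ρ)} := by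
    ext v
    simp only [Set.mem_ofPred_eq, Set.mem_inter_iff, Set.mem_iInter, Good,
      nonResonant_iff (hamiltonian_isHermitian hsym ε v) hL]
    refine and_congr_right fun hlow => ?_
    have hdet : 0 < ‖(M v).det‖ :=
      norm_pos_iff.2 (isUnit_iff_ne_zero.1 (hlow.isUnit_det (Real.exp_pos _)))
    have hgreen : ∀ a b, ‖green (hamiltonian ε φ v) (cube x L) E a b‖ =
        ‖(M v).adjugate a b‖ / ‖(M v).det‖ := by
      intro a b
      rw [green, Matrix.inv_def, Matrix.smul_apply, smul_eq_mul, norm_mul, Ring.inverse_eq_inv',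
        norm_inv, inv_mul_eq_div]
    simp only [hgreen, div_le_iff₀' hdet]
    exact ⟨fun h y hy => h _ y y.2 hy, fun h _ y hy hyx => h ⟨y, hy⟩ hyx⟩
  rw [heq]
  refine (isClosed_lowerBounded ε φ _ E _).inter (isClosed_iInter fun y => isClosed_iInter fun _ =>
    isClosed_le ?_ ?_)
  · exact (hM.matrix_adjugate.matrix_elem _ _).norm
  · exact hM.matrix_det.norm.mul continuous_const

/-- The potentials for which both cubes are bad at a common energy. -/
def badPair (ε : ℝ) (φ : Lattice d → ℂ) (ρ ρ' κ L : ℝ) (I : Set ℝ) (x y : Lattice d) :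
    Set (Lattice d → ℝ) :=
  {v | ∃ E ∈ I, Bad (hamiltonian ε φ v) ρ ρ' κ E x L ∧ Bad (hamiltonian ε φ v) ρ ρ' κ E y L}

/-- Openness survives the uncountable union over energies, so it settles measurability after
restriction to finitely many sites. -/
theorem isOpen_badPair {φ : Lattice d → ℂ} (hsym : ∀ x, φ x = starRingEnd ℂ (φ (-x)))
    (ε ρ ρ' κ : ℝ) {L : ℝ} (hL : 0 ≤ L) (I : Set ℝ) (x y : Lattice d) :
    IsOpen (badPair ε φ ρ ρ' κ L I x y) := by
  have : badPair ε φ ρ ρ' κ L I x y = ⋃ E ∈ I,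
      {v | Good (hamiltonian ε φ v) ρ ρ' κ E x L}ᶜ ∩
        {v | Good (hamiltonian ε φ v) ρ ρ' κ E y L}ᶜ := by
    ext v
    simp only [badPair, Bad, Set.mem_ofPred_eq, Set.mem_iUnion, Set.mem_inter_iff,
      Set.mem_compl_iff, exists_prop]
  rw [this]
  exact isOpen_biUnion fun E _ => (isClosed_good hsym ε ρ ρ' κ E x hL).isOpen_compl.inter
    (isClosed_good hsym ε ρ ρ' κ E y hL).isOpen_compl

theorem badPair_congr {ε : ℝ} {φ : Lattice d → ℂ} {ρ ρ' κ L : ℝ} {I : Set ℝ} {x y : Lattice d}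
    {v v' : Lattice d → ℝ} (h : ∀ z ∈ cube x L ∪ cube y L, v z = v' z) :
    v ∈ badPair ε φ ρ ρ' κ L I x y ↔ v' ∈ badPair ε φ ρ ρ' κ L I x y := by
  have hx := restrict_hamiltonian_congr (ε := ε) (φ := φ) (B := cube x L) (v := v) (v' := v')
    fun z hz => h z (Finset.mem_union_left _ hz)
  have hy := restrict_hamiltonian_congr (ε := ε) (φ := φ) (B := cube y L) (v := v) (v' := v')
    fun z hz => h z (Finset.mem_union_right _ hz)
  simp only [badPair, Set.mem_ofPred_eq, Bad, good_congr hx, good_congr hy]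

/-- Extension of a finite configuration by zero. -/
noncomputable def extendZero (S : Finset (Lattice d)) (u : S → ℝ) : Lattice d → ℝ :=
  fun z => if h : z ∈ S then u ⟨z, h⟩ else 0

theorem continuous_extendZero (S : Finset (Lattice d)) : Continuous (extendZero S) := by
  refine continuous_pi fun z => ?_
  unfold extendZero
  split_ifs <;> fun_prop

theorem extendZero_apply_of_mem {S : Finset (Lattice d)} {z : Lattice d} (hz : z ∈ S)
    (v : Lattice d → ℝ) : extendZero S (fun s => v s) z = v z := by
  simp [extendZero, hz]

/-! ### Independence and the Wegner estimate -/

section Probability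

variable {Ω : Type*} [MeasurableSpace Ω] {P : Measure Ω} {V : Lattice d → Ω → ℝ}

/-- Open events which depend on disjoint finite sets of sites are independent. -/
theorem measure_inter_eq_mul_of_dependsOn (hV : ∀ x, Measurable (V x)) (hind : iIndepFun V P)
    {S S' : Finset (Lattice d)} (hSS' : Disjoint S S') {U U' : Set (Lattice d → ℝ)}
    (hU : IsOpen U) (hU' : IsOpen U')
    (hS : ∀ v v', (∀ z ∈ S, v z = v' z) → (v ∈ U ↔ v' ∈ U))
    (hS' : ∀ v v', (∀ z ∈ S', v z = v' z) → (v ∈ U' ↔ v' ∈ U')) :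
    P {ω | (fun z => V z ω) ∈ U ∧ (fun z => V z ω) ∈ U'} =
      P {ω | (fun z => V z ω) ∈ U} * P {ω | (fun z => V z ω) ∈ U'} := by
  have h := (hind.indepFun_finset S S' hSS' hV).measure_inter_preimage_eq_mul
    (extendZero S ⁻¹' U) (extendZero S' ⁻¹' U')
    (hU.preimage (continuous_extendZero S)).measurableSet
    (hU'.preimage (continuous_extendZero S')).measurableSet
  have e : ∀ ω, extendZero S (fun s => V s ω) ∈ U ↔ (fun z => V z ω) ∈ U := fun ω =>
    hS _ _ fun z hz => extendZero_apply_of_mem hz fun z => V z ω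
  have e' : ∀ ω, extendZero S' (fun s => V s ω) ∈ U' ↔ (fun z => V z ω) ∈ U' := fun ω =>
    hS' _ _ fun z hz => extendZero_apply_of_mem hz fun z => V z ω
  simpa only [Set.preimage, e, e', Set.mem_ofPred_eq, Set.ofPred_and] using h

/-- Bound for an open event through its sections in the direction of one site. -/
theorem measure_le_of_sections [IsProbabilityMeasure P] {μ : Measure ℝ}
    (hV : ∀ x, Measurable (V x)) (hμ : ∀ x, P.map (V x) = μ) (hind : iIndepFun V P)
    {S : Finset (Lattice d)} {i : Lattice d} (hi : i ∉ S) {U : Set (Lattice d → ℝ)}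
    (hU : IsOpen U)
    (hS : ∀ v v', v i = v' i → (∀ z ∈ S, v z = v' z) → (v ∈ U ↔ v' ∈ U)) {s : ℝ≥0∞}
    (hs : ∀ u : Lattice d → ℝ, μ {a | Function.update u i a ∈ U} ≤ s) :
    P {ω | (fun z => V z ω) ∈ U} ≤ s := by
  have hμP : IsProbabilityMeasure μ := by
    rw [← hμ i]; exact Measure.isProbabilityMeasure_map (hV i).aemeasurable
  have hY : Measurable fun ω (j : S) => V j ω := measurable_pi_lambda _ fun j => hV j
  have hindep : IndepFun (V i) (fun ω (j : S) => V j ω) P :=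
    (hind.indepFun_finset {i} S (by simpa using hi) hV).comp
      (φ := fun u : ({i} : Finset (Lattice d)) → ℝ => u ⟨i, by simp⟩) (ψ := id)
      (measurable_pi_apply _) measurable_id
  -- The joint law of the site `i` and the remaining sites is a product, so Fubini reduces the bound
  -- to sections.
  have hmap := hindep.map_prod_eq_prod_map_map (hV i).aemeasurable hY.aemeasurable
  rw [hμ i] at hmap
  let m : ℝ × (S → ℝ) → Lattice d → ℝ := fun q => Function.update (extendZero S q.2) i q.1
  have hm : Continuous m :=
    ((continuous_extendZero S).comp continuous_snd).update i continuous_fst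
  have hC : MeasurableSet (m ⁻¹' U) := (hU.preimage hm).measurableSet
  have heq : {ω | (fun z => V z ω) ∈ U} =
      (fun ω => (V i ω, fun j : S => V j ω)) ⁻¹' (m ⁻¹' U) := by
    ext ω
    refine hS _ _ (by simp [m]) fun z hz => ?_
    have hzi : z ≠ i := fun h => hi (h ▸ hz)
    simp only [m, Function.update_of_ne hzi]
    exact (extendZero_apply_of_mem hz fun z => V z ω).symm
  have hPY : IsProbabilityMeasure (P.map fun ω (j : S) => V j ω) :=
    Measure.isProbabilityMeasure_map hY.aemeasurable
  rw [heq, ← Measure.map_apply ((hV i).prodMk hY) hC, hmap, Measure.prod_apply_symm hC]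
  refine (lintegral_mono (g := fun _ => s) fun u => hs _).trans ?_
  simp

/-- Wegner estimate: two disjoint regions are rarely resonant at a common energy. -/
theorem measure_common_resonance_le [IsProbabilityMeasure P] {μ : Measure ℝ}
    (hV : ∀ x, Measurable (V x)) (hμ : ∀ x, P.map (V x) = μ) (hind : iIndepFun V P)
    {φ : Lattice d → ℂ} (hsym : ∀ x, φ x = starRingEnd ℂ (φ (-x))) (ε : ℝ)
    {Λ Λ' : Finset (Lattice d)} (hdisj : Disjoint Λ Λ') {δ r : ℝ} (hδ : 0 < δ) {s : ℝ≥0∞}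
    (hr : 4 * δ * Λ.card ≤ r) (hs : ∀ a, μ (Set.Icc a (a + r)) ≤ s) :
    P {ω | ∃ E, ¬ LowerBounded (hamiltonian ε φ fun z => V z ω) δ E Λ ∧
        ¬ LowerBounded (hamiltonian ε φ fun z => V z ω) δ E Λ'} ≤
      Λ.card * (Λ'.card * s) := by
  -- Resonances are sorted by a site that carries at least the average mass of a normalised
  -- approximate eigenvector. The strict inequality keeps each class open.
  let U : Λ → Set (Lattice d → ℝ) := fun i => ⋃ (E : ℝ) (ψ : EuclideanSpace ℂ Λ)
    (_ : ‖ψ‖ = 1 ∧ (Λ.card : ℝ)⁻¹ ≤ ‖ψ i‖ ^ 2),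
    {v | ‖toEuclideanLin (restrict (hamiltonian ε φ v) Λ - (E : ℂ) • (1 : Matrix Λ Λ ℂ)) ψ‖ < δ} ∩
      {v | LowerBounded (hamiltonian ε φ v) δ E Λ'}ᶜ
  have hUo : ∀ i, IsOpen (U i) := fun i => isOpen_iUnion fun E => isOpen_iUnion fun ψ =>
    isOpen_iUnion fun _ => (isOpen_lt (continuous_norm_restrict_hamiltonian ε φ Λ E ψ)
      continuous_const).inter (isClosed_lowerBounded ε φ δ E Λ').isOpen_compl
  have hsub : {ω | ∃ E, ¬ LowerBounded (hamiltonian ε φ fun z => V z ω) δ E Λ ∧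
        ¬ LowerBounded (hamiltonian ε φ fun z => V z ω) δ E Λ'} ⊆
      ⋃ i : Λ, {ω | (fun z => V z ω) ∈ U i} := by
    rintro ω ⟨E, h1, h2⟩
    simp only [LowerBounded, not_forall, not_le] at h1
    obtain ⟨χ, hχ⟩ := h1
    have hχ0 : 0 < ‖χ‖ := by
      by_contra h0
      have h0' : χ = 0 := norm_le_zero_iff.1 (not_lt.1 h0)
      simp [h0'] at hχ
    let ψ : EuclideanSpace ℂ Λ := ((‖χ‖⁻¹ : ℝ) : ℂ) • χ
    have hψ : ‖ψ‖ = 1 := by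
      simp only [ψ, norm_smul, Complex.norm_real, norm_inv, norm_norm]
      exact inv_mul_cancel₀ hχ0.ne'
    have hψE : ‖toEuclideanLin (restrict (hamiltonian ε φ fun z => V z ω) Λ -
        (E : ℂ) • (1 : Matrix Λ Λ ℂ)) ψ‖ < δ := by
      simp only [ψ, map_smul, norm_smul, Complex.norm_real, norm_inv, norm_norm]
      rwa [inv_mul_eq_div, div_lt_iff₀ hχ0]
    have hex : ∃ i : Λ, (Λ.card : ℝ)⁻¹ ≤ ‖ψ i‖ ^ 2 := by
      have hsum : ∑ i : Λ, ‖ψ i‖ ^ 2 = 1 := by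
        rw [← EuclideanSpace.norm_sq_eq, hψ, one_pow]
      by_contra! hlt
      have hne : (Finset.univ : Finset Λ).Nonempty := by
        by_contra h0
        rw [Finset.not_nonempty_iff_eq_empty] at h0
        simp [h0] at hsum
      have h3 := Finset.sum_lt_sum_of_nonempty hne fun i _ => hlt i
      have h4 : (Λ.card : ℝ) ≠ 0 := by
        obtain ⟨i, _⟩ := hne
        exact Nat.cast_ne_zero.2 (Finset.card_ne_zero.2 ⟨i, i.2⟩)
      rw [hsum, Finset.sum_const, Finset.card_univ, Fintype.card_coe, nsmul_eq_mul,
        mul_inv_cancel₀ h4] at h3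
      exact lt_irrefl _ h3
    obtain ⟨i, hi⟩ := hex
    simp only [Set.mem_iUnion]
    exact ⟨i, Set.mem_iUnion.2 ⟨E, Set.mem_iUnion.2 ⟨ψ, Set.mem_iUnion.2 ⟨⟨hψ, hi⟩, hψE, h2⟩⟩⟩⟩
  have hsection : ∀ i : Λ, P {ω | (fun z => V z ω) ∈ U i} ≤ Λ'.card * s := by
    intro i
    have hiΛ' : (i : Lattice d) ∉ Λ' := Finset.disjoint_left.1 hdisj i.2
    refine measure_le_of_sections hV hμ hind (S := (Λ ∪ Λ').erase i) (i := i) (by simp) (hUo i)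
      ?_ ?_
    · intro v v' hvi hvS
      have hall : ∀ z ∈ Λ ∪ Λ', v z = v' z := fun z hz => by
        by_cases hzi : z = i
        · rw [hzi, hvi]
        · exact hvS z (Finset.mem_erase.2 ⟨hzi, hz⟩)
      have e1 := restrict_hamiltonian_congr (ε := ε) (φ := φ) (B := Λ) (v := v) (v' := v')
        fun z hz => hall z (Finset.mem_union_left _ hz)
      have e2 := restrict_hamiltonian_congr (ε := ε) (φ := φ) (B := Λ') (v := v) (v' := v')
        fun z hz => hall z (Finset.mem_union_right _ hz)
      simp only [U, Set.mem_iUnion, Set.mem_inter_iff, Set.mem_ofPred_eq, Set.mem_compl_iff, e1,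
        lowerBounded_congr e2]
    · intro u
      have hH := hamiltonian_isHermitian hsym ε u
      let e : Λ' → ℝ := (restrict_isHermitian hH Λ').eigenvalues
      let M : ℝ → Matrix Λ Λ ℂ := fun a => restrict (hamiltonian ε φ (Function.update u i a)) Λ
      -- The unknown energy is within `δ` of an eigenvalue `e k` of the other region, and `e k` does
      -- not depend on the potential at `i`. Replacing `E` by `e k` costs another `δ`. Each `T k`
      -- then has diameter at most `4 δ |Λ|`.
      let T : Λ' → Set ℝ := fun k => {a | ∃ ψ : EuclideanSpace ℂ Λ, ‖ψ‖ = 1 ∧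
        (Λ.card : ℝ)⁻¹ ≤ ‖ψ i‖ ^ 2 ∧
        ‖toEuclideanLin (M a - (e k : ℂ) • (1 : Matrix Λ Λ ℂ)) ψ‖ ≤ 2 * δ}
      have hcover : {a | Function.update u i a ∈ U i} ⊆ ⋃ k, T k := by
        intro a ha
        simp only [U, Set.mem_ofPred_eq, Set.mem_iUnion, Set.mem_inter_iff, Set.mem_compl_iff] at ha
        obtain ⟨E, ψ, ⟨hψ, hψi⟩, hE, hlow⟩ := ha
        have e2 := restrict_hamiltonian_congr (ε := ε) (φ := φ) (B := Λ')
          (v := Function.update u i a) (v' := u)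
          fun z hz => Function.update_of_ne (fun h : z = i => hiΛ' (h ▸ hz)) _ _
        rw [lowerBounded_congr e2] at hlow
        have hk : ∃ k, |e k - E| < δ := by
          by_contra! hk
          exact hlow (LowerBounded.of_eigenvalues hH hδ.le hk)
        obtain ⟨k, hk⟩ := hk
        refine Set.mem_iUnion.2 ⟨k, ψ, hψ, hψi, ?_⟩
        have h1 : toEuclideanLin (M a - (e k : ℂ) • (1 : Matrix Λ Λ ℂ)) ψ =
            toEuclideanLin (M a - (E : ℂ) • (1 : Matrix Λ Λ ℂ)) ψ - ((e k - E : ℝ) : ℂ) • ψ := by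
          rw [toEuclideanLin_sub_smul_one, toEuclideanLin_sub_smul_one, Complex.ofReal_sub,
            sub_smul]
          abel
        rw [h1]
        refine (norm_sub_le _ _).trans ?_
        rw [norm_smul, hψ, mul_one, Complex.norm_real, Real.norm_eq_abs]
        linarith [hE.le]
      refine (measure_mono hcover).trans ((measure_iUnion_fintype_le _ _).trans ?_)
      have hT : ∀ k, μ (T k) ≤ s := by
        intro k
        refine measure_le_of_forall_abs_sub_le hs ?_
        rintro a ⟨ψ, hψ, hψi, hψa⟩ a' ⟨ψ', hψ', hψi', hψa'⟩
        have hcard : (0 : ℝ) < Λ.card := Nat.cast_pos.2 (Finset.card_pos.2 ⟨i, i.2⟩)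
        refine (abs_le_of_approx_eigenvectors (A := M a) (A' := M a') (i := i) (E := e k)
          (restrict_isHermitian (hamiltonian_isHermitian hsym ε _) Λ) hcard ?_ hψ hψ' hψi hψi' hψa
          hψa').trans (by linarith)
        ext p q
        simp only [M, restrict, hamiltonian, Matrix.sub_apply, submatrix_apply, of_apply,
          Matrix.single_apply]
        by_cases hp : p = i
        · subst hp
          by_cases hq : p = q
          · subst hq; simp
          · have : (p : Lattice d) ≠ q := fun h => hq (Subtype.ext h)
            simp [this, hq]
        · have h1 : (p : Lattice d) ≠ i := fun h => hp (Subtype.ext h)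
          have h2 : ¬ (i = p ∧ i = q) := fun h => hp h.1.symm
          simp [Function.update_of_ne h1, h2]
      refine (Finset.sum_le_card_nsmul _ _ _ fun k _ => hT k).trans ?_
      simp
  refine (measure_mono hsub).trans ((measure_iUnion_fintype_le _ _).trans ?_)
  refine (Finset.sum_le_card_nsmul _ _ _ fun i _ => hsection i).trans ?_
  simp

end Probability

/-! ### Asymptotic estimates and the decay rates -/

theorem eventually_mul_rpow_le_mul_rpow {a b : ℝ} (hab : a < b) (C : ℝ) {c : ℝ} (hc : 0 < c) :
    ∀ᶠ m : ℝ in atTop, C * m ^ a ≤ c * m ^ b := by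
  have h : Tendsto (fun m : ℝ => C * m ^ (-(b - a))) atTop (𝓝 (C * 0)) :=
    (tendsto_rpow_neg_atTop (sub_pos.2 hab)).const_mul C
  rw [mul_zero] at h
  filter_upwards [h.eventually (ge_mem_nhds hc), eventually_gt_atTop 0] with m hm hm0
  calc C * m ^ a = C * m ^ (-(b - a)) * m ^ b := by
        rw [mul_assoc, ← Real.rpow_add hm0]; congr 2; ring
    _ ≤ c * m ^ b := mul_le_mul_of_nonneg_right hm (Real.rpow_nonneg hm0.le _)

/-- Bernoulli's inequality. Shortening a hop by a constant factor shifts the logarithm by `c`, which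
costs only a relative error `ρ c / T`. -/
theorem sub_rpow_ge {ρ c T : ℝ} (hρ : 1 ≤ ρ) (hT : 0 < T) (hcT : c ≤ T) :
    T ^ ρ * (1 - ρ * (c / T)) ≤ (T - c) ^ ρ := by
  have h4 : -1 ≤ -(c / T) := by
    rw [neg_le_neg_iff, div_le_one hT]; exact hcT
  have h5 := one_add_mul_self_le_rpow_one_add h4 hρ
  have h7 : (T - c) ^ ρ = T ^ ρ * (1 + -(c / T)) ^ ρ := by
    rw [← Real.mul_rpow hT.le (by linarith)]
    congr 1
    field_simp
    ring
  rw [h7]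
  exact mul_le_mul_of_nonneg_left (by linarith) (Real.rpow_nonneg hT.le _)

theorem eventually_half_rpow_le_sub_rpow {ρ : ℝ} (hρ : 1 ≤ ρ) (c : ℝ) :
    ∀ᶠ m : ℝ in atTop, m ^ ρ / 2 ≤ (m - c) ^ ρ := by
  filter_upwards [eventually_ge_atTop (2 * ρ * c), eventually_ge_atTop c, eventually_gt_atTop 0]
    with m h1 h2 h3
  have h4 : ρ * (c / m) ≤ 1 / 2 := by
    rw [← mul_div_assoc, div_le_iff₀ h3]; linarith
  refine le_trans ?_ (sub_rpow_ge hρ h3 h2)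
  rw [div_eq_mul_one_div]
  exact mul_le_mul_of_nonneg_left (by linarith) (Real.rpow_nonneg h3.le _)

/-- With `r > 1`, `exp(-c log^r L)` is smaller than every power of `L`; volume factors are therefore
negligible against the resonance threshold. -/
theorem eventually_mul_rpow_mul_exp_le_one (C q : ℝ) {c r : ℝ} (hc : 0 < c) (hr : 1 < r) :
    ∀ᶠ L : ℝ in atTop, C * L ^ q * Real.exp (-c * (Real.log L) ^ r) ≤ 1 := by
  have h1 : ∀ᶠ m : ℝ in atTop, (1 + q) * m ^ (1 : ℝ) ≤ c * m ^ r :=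
    eventually_mul_rpow_le_mul_rpow hr _ hc
  filter_upwards [Real.tendsto_log_atTop.eventually h1, eventually_gt_atTop 0,
    eventually_ge_atTop C] with L h1 hL hC
  rw [Real.rpow_one] at h1
  calc C * L ^ q * Real.exp (-c * (Real.log L) ^ r)
      ≤ L * L ^ q * Real.exp (-c * (Real.log L) ^ r) := by
        gcongr
    _ = Real.exp ((1 + q) * Real.log L + -c * (Real.log L) ^ r) := by
        rw [Real.exp_add, mul_comm (1 + q), ← Real.rpow_def_of_pos hL, Real.rpow_add hL,
          Real.rpow_one]
    _ ≤ 1 := Real.exp_le_one_iff.2 (by linarith)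

theorem eventually_mul_rpow_le_one (C : ℝ) {q : ℝ} (hq : q < 0) :
    ∀ᶠ L : ℝ in atTop, C * L ^ q ≤ 1 := by
  simpa using eventually_mul_rpow_le_mul_rpow hq C one_pos

theorem card_cube_le (x : Lattice d) {L : ℝ} (hL : 1 ≤ L) :
    ((cube x L).card : ℝ) ≤ (3 * L) ^ d := by
  have hsub : cube x L ⊆ Fintype.piFinset fun i => Finset.Icc (x i - ⌊L⌋) (x i + ⌊L⌋) := by
    intro y hy
    rw [mem_cube, pi_norm_le_iff_of_nonneg (by linarith)] at hy
    rw [Fintype.mem_piFinset]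
    intro i
    have h1 := hy i
    rw [Pi.sub_apply, Int.norm_eq_abs, ← Int.cast_abs, ← Int.le_floor, abs_le] at h1
    rw [Finset.mem_Icc]
    omega
  have h1 := Finset.card_le_card hsub
  rw [Fintype.card_piFinset] at h1
  simp only [Int.card_Icc] at h1
  have hfl : 0 ≤ ⌊L⌋ := Int.floor_nonneg.2 (by linarith)
  have h2 : ∀ i : Fin d, (x i + ⌊L⌋ + 1 - (x i - ⌊L⌋)).toNat = (2 * ⌊L⌋ + 1).toNat := fun i => by
    congr 1; ring
  simp only [h2, Finset.prod_const, Finset.card_univ, Fintype.card_fin] at h1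
  have h3 : (((2 * ⌊L⌋ + 1).toNat : ℕ) : ℝ) ≤ 3 * L := by
    have h4 : (((2 * ⌊L⌋ + 1).toNat : ℕ) : ℤ) = 2 * ⌊L⌋ + 1 := Int.toNat_of_nonneg (by omega)
    have h5 : (((2 * ⌊L⌋ + 1).toNat : ℕ) : ℝ) = 2 * (⌊L⌋ : ℝ) + 1 := by exact_mod_cast h4
    rw [h5]
    linarith [Int.floor_le L]
  calc ((cube x L).card : ℝ) ≤ (((2 * ⌊L⌋ + 1).toNat ^ d : ℕ) : ℝ) := by exact_mod_cast h1
    _ = (((2 * ⌊L⌋ + 1).toNat : ℕ) : ℝ) ^ d := by push_cast; rfl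
    _ ≤ (3 * L) ^ d := pow_le_pow_left₀ (Nat.cast_nonneg _) h3 d

/-- The decay rate used at the scale `L`, decreasing to `κinf`. -/
noncomputable def rate (κ₀ κinf σ L : ℝ) : ℝ := κinf + (κ₀ - κinf) * (Real.log L) ^ (-σ)

theorem Good.mono {H : Matrix (Lattice d) (Lattice d) ℂ} {ρ ρ' κ κ' E L : ℝ} {x : Lattice d}
    (h : Good H ρ ρ' κ E x L) (hκ : κ' ≤ κ) : Good H ρ ρ' κ' E x L := by
  refine ⟨h.1, fun hx y hy hxy => (h.2 hx y hy hxy).trans (Real.exp_le_exp.2 ?_)⟩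
  have : 0 ≤ (Real.log (‖x - y‖ + 1)) ^ ρ :=
    Real.rpow_nonneg (Real.log_nonneg (by linarith [norm_nonneg (x - y)])) _
  nlinarith

/-- The numerical estimates behind the induction step, in terms of `m = log l`. -/
theorem eventually_rate_estimates {ρ ρ' κ₀ κinf : ℝ} (hρ : 1 < ρ) (hρ'ρ : ρ' < ρ)
    (hκinf : 0 < κinf) (hκ : κinf < κ₀) {σ : ℝ} (hσ0 : 0 < σ) (hσ1 : σ < 1) (hσρ : σ < ρ - ρ')
    (C c : ℝ) (hC : 0 ≤ C) (hc : 0 ≤ c) {N : ℕ} (hN : 4 * (3 ^ ρ + 1) ≤ (N : ℝ)) :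
    ∀ᶠ m : ℝ in atTop, ∀ κ κ' : ℝ, κ = κinf + (κ₀ - κinf) * m ^ (-σ) → κinf ≤ κ' →
      κ' ≤ κinf + (κ₀ - κinf) * (5 / 4 * m) ^ (-σ) →
      2 * (C * m ^ ρ') ≤ κ * (m - Real.log 2) ^ ρ ∧
      (∀ T, 0 ≤ T → T ≤ 3 * m →
        C * m ^ ρ' + N * (2 * (C * m ^ ρ') - κ * (m - Real.log 2) ^ ρ) ≤ -κ' * T ^ ρ) ∧
      ∀ T, m ≤ T → 3 * (C * m ^ ρ') - κ * (T - c) ^ ρ ≤ -κ' * T ^ ρ := by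
  have hgap : 0 < 1 - (5 / 4 : ℝ) ^ (-σ) := by
    have := Real.rpow_lt_one_of_one_lt_of_neg (x := 5 / 4) (z := -σ) (by norm_num) (by linarith)
    linarith
  have hκ0 : 0 < κ₀ := hκinf.trans hκ
  have e1 := eventually_mul_rpow_le_mul_rpow hρ'ρ (2 * C) (c := κinf / 4) (by linarith)
  have e2 := eventually_half_rpow_le_sub_rpow hρ.le (Real.log 2)
  have e3 := eventually_mul_rpow_le_mul_rpow (a := -1) (b := -σ) (by linarith) (κ₀ * ρ * c)
    (c := (κ₀ - κinf) * (1 - (5 / 4 : ℝ) ^ (-σ)) / 2)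
    (by have := mul_pos (sub_pos.2 hκ) hgap; linarith)
  have e4 := eventually_mul_rpow_le_mul_rpow (a := ρ' - ρ) (b := -σ) (by linarith) (3 * C)
    (c := (κ₀ - κinf) * (1 - (5 / 4 : ℝ) ^ (-σ)) / 2)
    (by have := mul_pos (sub_pos.2 hκ) hgap; linarith)
  filter_upwards [e1, e2, e3, e4, eventually_ge_atTop 1, eventually_ge_atTop c]
    with m h1 h2 h3 h4 hm1 hmc κ κ' hκeq hκ'inf hκ'
  have hm0 : 0 < m := by linarith
  have hmσ : m ^ (-σ) ≤ 1 := Real.rpow_le_one_of_one_le_of_nonpos hm1 (by linarith)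
  have hmσ0 : 0 < m ^ (-σ) := Real.rpow_pos_of_pos hm0 _
  have hκinfκ : κinf ≤ κ := by
    rw [hκeq]; have := mul_pos (sub_pos.2 hκ) hmσ0; linarith
  have hκκ₀ : κ ≤ κ₀ := by
    rw [hκeq]
    have := mul_le_mul_of_nonneg_left hmσ (sub_pos.2 hκ).le
    linarith
  -- The drop of the rate between consecutive scales. Half of it pays for the shift `c`, half for
  -- the resonance factor, as arranged in `h3` and `h4`.
  have hdiff : κ' + (κ₀ - κinf) * (1 - (5 / 4 : ℝ) ^ (-σ)) * m ^ (-σ) ≤ κ := by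
    rw [Real.mul_rpow (by norm_num) hm0.le] at hκ'
    rw [hκeq]; linarith
  have hκ'κ : κ' ≤ κ := by
    have := mul_pos (mul_pos (sub_pos.2 hκ) hgap) hmσ0; linarith
  have hmρ : 0 < m ^ ρ := Real.rpow_pos_of_pos hm0 _
  have hκm : κinf / 4 * m ^ ρ ≤ κ / 4 * m ^ ρ :=
    mul_le_mul_of_nonneg_right (by linarith) hmρ.le
  have hκm2 : κ * (m ^ ρ / 2) ≤ κ * (m - Real.log 2) ^ ρ :=
    mul_le_mul_of_nonneg_left h2 (by linarith)
  have hκpos : 0 < κ := hκinf.trans_le hκinfκ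
  have hκmpos : 0 < κ * m ^ ρ := mul_pos hκpos hmρ
  refine ⟨by linarith, fun T hT0 hT => ?_, fun T hT => ?_⟩
  · have h5 : T ^ ρ ≤ 3 ^ ρ * m ^ ρ := by
      rw [← Real.mul_rpow (by norm_num) hm0.le]
      exact Real.rpow_le_rpow hT0 hT (by linarith)
    have h6 : κ' * T ^ ρ ≤ κ * (3 ^ ρ * m ^ ρ) :=
      mul_le_mul hκ'κ h5 (Real.rpow_nonneg hT0 _) hκpos.le
    have h7 : 2 * (C * m ^ ρ') - κ * (m - Real.log 2) ^ ρ ≤ -(κ * m ^ ρ / 4) := by linarith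
    have h8 := mul_le_mul_of_nonneg_left h7 (Nat.cast_nonneg (α := ℝ) N)
    -- Of the factor `3^ρ + 1`, the part `3^ρ` covers `T ≤ 3 m` and the remaining 1 absorbs the
    -- prefactor.
    have h9 := mul_le_mul_of_nonneg_right hN (show 0 ≤ κ * m ^ ρ / 4 by linarith)
    linarith
  · have hT0 : 0 < T := hm0.trans_le hT
    have h5 := sub_rpow_ge hρ.le hT0 (hmc.trans hT)
    have hTρ : 0 < T ^ ρ := Real.rpow_pos_of_pos hT0 _
    have h6 : m ^ ρ' ≤ m ^ (ρ' - ρ) * T ^ ρ := by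
      calc m ^ ρ' = m ^ (ρ' - ρ) * m ^ ρ := by rw [← Real.rpow_add hm0]; congr 1; ring
        _ ≤ _ := mul_le_mul_of_nonneg_left (Real.rpow_le_rpow hm0.le hT (by linarith))
          (Real.rpow_nonneg hm0.le _)
    have h7 : c / T ≤ c * m ^ (-1 : ℝ) := by
      rw [Real.rpow_neg_one, ← div_eq_mul_inv]
      exact div_le_div_of_nonneg_left hc hm0 hT
    have h8 : κ * (ρ * (c / T)) ≤ κ₀ * ρ * c * m ^ (-1 : ℝ) := by
      have h9 : ρ * (c / T) ≤ ρ * (c * m ^ (-1 : ℝ)) :=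
        mul_le_mul_of_nonneg_left h7 (by linarith)
      have h10 : 0 ≤ ρ * (c / T) := by positivity
      calc _ ≤ κ₀ * (ρ * (c * m ^ (-1 : ℝ))) := mul_le_mul hκκ₀ h9 h10 hκ0.le
        _ = _ := by ring
    have h11 : 3 * (C * m ^ ρ') ≤ 3 * C * m ^ (ρ' - ρ) * T ^ ρ := by
      have := mul_le_mul_of_nonneg_left h6 (show 0 ≤ 3 * C by linarith)
      linarith
    have h12 := mul_le_mul_of_nonneg_left h5 hκpos.le
    have h13 : κ' + κ * (ρ * (c / T)) + 3 * C * m ^ (ρ' - ρ) ≤ κ := by linarith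
    have h14 := mul_le_mul_of_nonneg_right h13 hTρ.le
    linarith

theorem le_rate {κ₀ κinf σ L : ℝ} (hκ : κinf ≤ κ₀) (hL : 1 ≤ L) : κinf ≤ rate κ₀ κinf σ L :=
  le_add_of_nonneg_right
    (mul_nonneg (sub_nonneg.2 hκ) (Real.rpow_nonneg (Real.log_nonneg hL) _))

theorem rate_le {κ₀ κinf σ L : ℝ} (hκ : κinf ≤ κ₀) (hσ : 0 ≤ σ) (hL : 1 ≤ Real.log L) :
    rate κ₀ κinf σ L ≤ κ₀ := by
  have h1 : (Real.log L) ^ (-σ) ≤ 1 := Real.rpow_le_one_of_one_le_of_nonpos hL (by linarith)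
  have h2 := mul_le_mul_of_nonneg_left h1 (sub_nonneg.2 hκ)
  unfold rate
  linarith

/-! ### The deterministic induction step -/

/-- The deterministic induction step: a cube without resonant subcubes and without four separated
bad subcubes is good, with a slightly smaller rate. -/
theorem eventually_good_of_subcubes {φ : Lattice d → ℂ}
    (hsym : ∀ x, φ x = starRingEnd ℂ (φ (-x))) {γ ρ ρ' κ₀ κinf σ a : ℝ} (hρ : 1 < ρ)
    (hφ : ∀ x, ‖φ x‖ ≤ Real.exp (-γ * (Real.log (‖x‖ + 1)) ^ ρ)) (hρ' : 1 < ρ') (hρ'ρ : ρ' < ρ)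
    (hκinf : 0 < κinf) (hκ : κinf < κ₀) (hκγ : κ₀ ≤ γ) (hσ0 : 0 < σ) (hσ1 : σ < 1)
    (hσρ : σ < ρ - ρ') (ha : 5 / 4 < a) :
    ∀ᶠ l : ℝ in atTop, ∀ L : ℝ, l ^ a ≤ L → L ≤ l ^ (2 : ℝ) →
      ∀ (ε E : ℝ) (V : Lattice d → ℝ) (x : Lattice d), 0 ≤ ε → ε ≤ 1 →
      LowerBounded (hamiltonian ε φ V) (Real.exp (-(Real.log L) ^ ρ')) E (cube x L) →
      (∀ w ∈ cube x L, ∀ k : ℕ, 1 ≤ k → k ≤ 4 →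
        LowerBounded (hamiltonian ε φ V) (Real.exp (-(Real.log L) ^ ρ')) E
          (cube w (10 * k * l) ∩ cube x L)) →
      (∀ z : Fin 4 → Lattice d, (∀ i, z i ∈ cube x L) → (∀ i j, i ≠ j → 2 * l < ‖z i - z j‖) →
        ∃ i, Good (hamiltonian ε φ V) ρ ρ' (rate κ₀ κinf σ l) E (z i) l) →
      Good (hamiltonian ε φ V) ρ ρ' (rate κ₀ κinf σ L) E x L := by
  obtain ⟨N, hN⟩ : ∃ N : ℕ, 4 * ((3 : ℝ) ^ ρ + 1) ≤ (N : ℝ) := exists_nat_ge _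
  have hN1 : (1 : ℝ) ≤ N := by
    have : (0 : ℝ) ≤ 3 ^ ρ := by positivity
    linarith
  set c := Real.log (336 * N)
  set C : ℝ := 2 ^ ρ' + 1
  have hc : 0 ≤ c := Real.log_nonneg (by linarith)
  have hC : 0 ≤ C := by positivity
  have e1 := Real.tendsto_log_atTop.eventually
    (eventually_rate_estimates hρ hρ'ρ hκinf hκ hσ0 hσ1 hσρ C c hC hc hN)
  have e2 := eventually_mul_rpow_le_mul_rpow (a := 4 / 5) (b := 1) (by norm_num) 1
    (c := 1 / 2) (by norm_num)
  have e3 := eventually_mul_rpow_mul_exp_le_one ((3 : ℝ) ^ (2 * d)) ((4 * d : ℕ) : ℝ)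
    (c := 1) one_pos hρ'
  have e4 := eventually_mul_rpow_le_mul_rpow (a := 1) (b := a * (4 / 5)) (by linarith) 200
    (c := 1) one_pos
  filter_upwards [e1, e2, e3, e4, eventually_ge_atTop 2,
    Real.tendsto_log_atTop.eventually (eventually_ge_atTop 1),
    Real.tendsto_log_atTop.eventually (eventually_ge_atTop c)]
    with l h1 h2 h3 h4 hl2 hm1 hmc L hlL hLl ε E V x hε hε1 hB hsub hbad
  set m := Real.log l with hm
  have hl0 : 0 < l := by linarith
  have hm0 : 0 < m := by linarith
  rw [Real.rpow_one] at h2 h4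
  rw [one_mul] at h2 h4
  have hlL' : l ≤ L := by
    refine le_trans ?_ hlL
    conv_lhs => rw [← Real.rpow_one l]
    exact Real.rpow_le_rpow_of_exponent_le (by linarith) (by linarith)
  have hL0 : 0 < L := by linarith
  have hL1 : 1 ≤ L := by linarith
  have hlogL1 : 5 / 4 * m ≤ Real.log L := by
    have := Real.log_le_log (Real.rpow_pos_of_pos hl0 a) hlL
    rw [Real.log_rpow hl0] at this
    have h5 := mul_le_mul_of_nonneg_right ha.le hm0.le
    linarith
  have hlogL2 : Real.log L ≤ 2 * m := by
    have := Real.log_le_log hL0 hLl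
    rwa [Real.log_rpow hl0] at this
  set κ := rate κ₀ κinf σ l with hκdef
  set κ' := rate κ₀ κinf σ L with hκ'def
  have hκ'inf : κinf ≤ κ' := le_rate hκ.le hL1
  have hκ'le : κ' ≤ κinf + (κ₀ - κinf) * (5 / 4 * m) ^ (-σ) := by
    have h5 : (Real.log L) ^ (-σ) ≤ (5 / 4 * m) ^ (-σ) :=
      Real.rpow_le_rpow_of_nonpos (by linarith) hlogL1 (by linarith)
    have := mul_le_mul_of_nonneg_left h5 (sub_pos.2 hκ).le
    simp only [hκ'def, rate]
    linarith
  obtain ⟨r1, r2, r3⟩ := h1 κ κ' rfl hκ'inf hκ'le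
  have hκinfκ : κinf ≤ κ := le_rate hκ.le (by linarith)
  have hκκ₀ : κ ≤ κ₀ := rate_le hκ.le hσ0.le hm1
  set A := Real.exp (C * m ^ ρ')
  have hdecayl : hopDecay κ ρ l = Real.exp (-κ * (m - Real.log 2) ^ ρ) := by
    rw [hopDecay, Real.log_div hl0.ne' two_ne_zero]
  have hA2 : A ^ 2 * hopDecay κ ρ l = Real.exp (2 * (C * m ^ ρ') - κ * (m - Real.log 2) ^ ρ) := by
    rw [hdecayl, ← Real.exp_nat_mul, ← Real.exp_add]
    congr 1
    push_cast
    ring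
  -- In `C = 2^ρ' + 1`, the summand 1 pays for the volume and `2^ρ'` for the resonance threshold, as
  -- `log L ≤ 2 m`.
  have hAcard : ((cube x L).card : ℝ) ^ 2 * (Real.exp (-(Real.log L) ^ ρ'))⁻¹ ≤ A := by
    have h5 : ((cube x L).card : ℝ) ^ 2 ≤ (3 : ℝ) ^ (2 * d) * l ^ ((4 * d : ℕ) : ℝ) := by
      have h6 : ((cube x L).card : ℝ) ≤ (3 * l ^ 2) ^ d := by
        refine (card_cube_le x hL1).trans (pow_le_pow_left₀ (by linarith) ?_ d)
        rw [← Real.rpow_two]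
        linarith
      refine (pow_le_pow_left₀ (Nat.cast_nonneg _) h6 2).trans_eq ?_
      rw [Real.rpow_natCast, ← pow_mul, mul_pow, ← pow_mul]
      congr 2 <;> ring
    have h7 : (3 : ℝ) ^ (2 * d) * l ^ ((4 * d : ℕ) : ℝ) ≤ Real.exp (m ^ ρ') := by
      have h8 : Real.exp (-1 * m ^ ρ') = (Real.exp (m ^ ρ'))⁻¹ := by
        rw [neg_one_mul, Real.exp_neg]
      rw [h8, ← div_eq_mul_inv, div_le_one (Real.exp_pos _)] at h3
      exact h3
    have h9 : (Real.log L) ^ ρ' ≤ 2 ^ ρ' * m ^ ρ' := by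
      rw [← Real.mul_rpow (by norm_num) hm0.le]
      exact Real.rpow_le_rpow (by linarith) hlogL2 (by linarith)
    rw [← Real.exp_neg, neg_neg]
    calc _ ≤ Real.exp (m ^ ρ') * Real.exp (2 ^ ρ' * m ^ ρ') :=
          mul_le_mul (h5.trans h7) (Real.exp_le_exp.2 h9) (Real.exp_pos _).le (Real.exp_pos _).le
      _ = A := by
          rw [← Real.exp_add]
          congr 1
          simp only [C]
          ring
  have hδ1 : Real.exp (-(Real.log L) ^ ρ') ≤ 1 :=
    Real.exp_le_one_iff.2 (neg_nonpos.2 (Real.rpow_nonneg (by linarith) _))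
  have hδl : Real.exp (-(Real.log L) ^ ρ') ≤ Real.exp (-(Real.log l) ^ ρ') :=
    Real.exp_le_exp.2 (neg_le_neg (Real.rpow_le_rpow hm0.le
      (Real.log_le_log hl0 hlL') (by linarith)))
  refine ⟨(nonResonant_iff (hamiltonian_isHermitian hsym ε V) hL0.le).2 hB, ?_⟩
  intro hx y hy hxy
  rw [← greenExt_of_mem hx hy]
  -- Here `a > 5/4` is needed: distances beyond `L^{4/5}` exceed twice the stopping distance `100 l`
  -- of the hops.
  have h200 : 200 * l ≤ L ^ (4 / 5 : ℝ) := by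
    refine h4.trans ?_
    rw [Real.rpow_mul hl0.le]
    exact Real.rpow_le_rpow (Real.rpow_nonneg hl0.le _) hlL (by norm_num)
  set t := ‖y - x‖ with ht
  have htL : t ≤ L := mem_cube.1 hy
  rw [norm_sub_rev x y, ← ht]
  have hT1 : m ≤ Real.log (t + 1) := Real.log_le_log hl0 (by linarith)
  have hT2 : Real.log (t + 1) ≤ 3 * m := by
    have h5 : t + 1 ≤ l ^ (3 : ℝ) := by
      have h6 : l ^ (3 : ℝ) = l ^ (2 : ℝ) * l := by
        rw [← Real.rpow_add_one hl0.ne']; norm_num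
      rw [h6]
      have h7 := mul_le_mul_of_nonneg_left hl2 (Real.rpow_nonneg hl0.le 2)
      linarith
    have := Real.log_le_log (by linarith) h5
    rwa [Real.log_rpow hl0] at this
  rcases greenExt_decay_alternative hsym (hκinf.le.trans hκinfκ) (hκκ₀.trans hκγ) (by linarith) hφ
    hε hε1 hl2 (by linarith) (Real.exp_pos _) hδ1 hδl hAcard
    (by rw [hA2]; exact Real.exp_le_one_iff.2 (by linarith)) hB hsub hbad hy (by linarith) N with
    h | ⟨b, hlb, htb, h⟩
  · refine h.trans ?_
    rw [hA2, ← Real.exp_nat_mul, ← Real.exp_add]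
    exact Real.exp_le_exp.2 (r2 _ (by linarith) hT2)
  · refine h.trans ?_
    have hb0 : 0 < b := by linarith
    -- From `t > 200 l` and `t ≤ 100 l + 42 N b` follows `t ≤ 84 N b`; then `t + 1 ≤ 2 t` and the
    -- halving in `hopDecay` give `336`.
    have h5 : (t + 1) / (336 * N) ≤ b / 2 := by
      rw [div_le_iff₀ (by linarith)]
      linarith
    have h6 : Real.log (t + 1) - c ≤ Real.log (b / 2) := by
      rw [← Real.log_div (by linarith) (by linarith)]
      exact Real.log_le_log (div_pos (by linarith) (by linarith)) h5
    have h7 := Real.rpow_le_rpow (z := ρ) (by linarith) h6 (by linarith)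
    have h8 := mul_le_mul_of_nonneg_left h7 (hκinf.le.trans hκinfκ)
    have h9 := r3 _ hT1
    have h10 : A * (A ^ 2 * hopDecay κ ρ b) =
        Real.exp (3 * (C * m ^ ρ') - κ * (Real.log (b / 2)) ^ ρ) := by
      rw [hopDecay, ← Real.exp_nat_mul, ← Real.exp_add, ← Real.exp_add]
      congr 1
      push_cast
      ring
    rw [h10]
    exact Real.exp_le_exp.2 (by linarith)

/-! ### The initial scale at weak hopping -/

theorem disjoint_cube {x y : Lattice d} {L : ℝ} (h : 2 * L < ‖x - y‖) :
    Disjoint (cube x L) (cube y L) := by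
  rw [Finset.disjoint_left]
  intro z hx hy
  rw [mem_cube] at hx hy
  have h1 : ‖x - y‖ ≤ ‖x - z‖ + ‖z - y‖ := norm_sub_le_norm_sub_add_norm_sub _ _ _
  rw [norm_sub_rev x z] at h1
  linarith

/-- Gershgorin: every eigenvalue is within `ε |B| ≤ δ` of some value of the potential. -/
theorem lowerBounded_of_large_potential {φ : Lattice d → ℂ}
    (hsym : ∀ x, φ x = starRingEnd ℂ (φ (-x))) (hφ : ∀ x, ‖φ x‖ ≤ 1) {ε δ E : ℝ} (hε : 0 ≤ ε)
    (hδ : 0 ≤ δ) {V : Lattice d → ℝ} {B : Finset (Lattice d)} (hεB : ε * B.card ≤ δ)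
    (hV : ∀ z ∈ B, 2 * δ ≤ |V z - E|) : LowerBounded (hamiltonian ε φ V) δ E B := by
  have hH := hamiltonian_isHermitian hsym ε V
  refine LowerBounded.of_eigenvalues hH hδ fun k => ?_
  set e := (restrict_isHermitian hH B).eigenvalues k
  have he : Module.End.HasEigenvalue (Matrix.toLin' (restrict (hamiltonian ε φ V) B)) (e : ℂ) := by
    rw [Module.End.hasEigenvalue_iff_mem_spectrum, spectrum_toLin']
    exact (spectrum.algebraMap_mem_iff ℂ).2
      ((restrict_isHermitian hH B).eigenvalues_mem_spectrum_real k)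
  obtain ⟨j, hj⟩ := eigenvalue_mem_ball he
  rw [Metric.mem_closedBall, dist_eq_norm] at hj
  have hbound : ∀ q : B, ‖(ε : ℂ) * φ (j - q)‖ ≤ ε := fun q => by
    rw [norm_mul, Complex.norm_real, Real.norm_eq_abs, abs_of_nonneg hε]
    exact mul_le_of_le_one_right hε (hφ _)
  have hoff : ∀ q ∈ Finset.univ.erase j, ‖restrict (hamiltonian ε φ V) B j q‖ ≤ ε := by
    intro q hq
    have hne : (j : Lattice d) ≠ q := fun h => (Finset.mem_erase.1 hq).1 (Subtype.ext h).symm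
    simpa [restrict, hamiltonian, hne] using hbound q
  have hsum := Finset.sum_le_card_nsmul _ _ _ hoff
  have hcard : ((Finset.univ.erase j).card : ℝ) + 1 = B.card := by
    have := Finset.card_erase_add_one (Finset.mem_univ j)
    rw [Finset.card_univ, Fintype.card_coe] at this
    exact_mod_cast this
  rw [nsmul_eq_mul] at hsum
  have hdiag : restrict (hamiltonian ε φ V) B j j = (ε : ℂ) * φ (j - j) + (V j : ℂ) := by
    simp [restrict, hamiltonian]
  have h1 : |e - V j| ≤ δ := by
    have h2 : ((e - V j : ℝ) : ℂ) =
        ((e : ℂ) - restrict (hamiltonian ε φ V) B j j) + (ε : ℂ) * φ (j - j) := by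
      rw [hdiag]; push_cast; ring
    rw [← Real.norm_eq_abs, ← Complex.norm_real, h2]
    refine (norm_add_le _ _).trans ?_
    have h3 : ((Finset.univ.erase j).card : ℝ) * ε + ε = ε * B.card := by rw [← hcard]; ring
    linarith [hbound j]
  have h4 := hV j j.2
  have h5 : |V j - E| ≤ |e - V j| + |e - E| := by
    have := abs_sub_le (V j) e E
    rwa [abs_sub_comm (V j) e] at this
  linarith

/-- Row `x` of `(H_B - E) G = 1` expresses the entry at `(x, y)` through off-diagonal terms, each
carrying a factor `ε`, divided by a diagonal entry of size at least `δ`. -/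
theorem norm_greenExt_le_of_large_potential {φ : Lattice d → ℂ} (hφ : ∀ x, ‖φ x‖ ≤ 1)
    {ε δ E : ℝ} (hε : 0 ≤ ε) (hδ : 0 < δ) {V : Lattice d → ℝ} {B : Finset (Lattice d)}
    (hεδ : ε ≤ δ) (hB : LowerBounded (hamiltonian ε φ V) δ E B) {x y : Lattice d} (hx : x ∈ B)
    (hy : y ∈ B) (hxy : x ≠ y) (hV : 2 * δ ≤ |V x - E|) :
    ‖greenExt (hamiltonian ε φ V) B E x y‖ ≤ ε * B.card * δ⁻¹ * δ⁻¹ := by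
  have h := sum_subEnergy_mul_greenExt (hB.isUnit_det hδ) hx hy
  rw [if_neg hxy, ← Finset.add_sum_erase B _ hx] at h
  have h1 : ‖subEnergy (hamiltonian ε φ V) E x x * greenExt (hamiltonian ε φ V) B E x y‖ ≤
      B.card * (ε * δ⁻¹) := by
    rw [eq_neg_of_add_eq_zero_left h, norm_neg]
    refine (norm_sum_le _ _).trans ?_
    have hterm : ∀ q ∈ B.erase x, ‖subEnergy (hamiltonian ε φ V) E x q *
        greenExt (hamiltonian ε φ V) B E q y‖ ≤ ε * δ⁻¹ := by
      intro q hq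
      have hne : x ≠ q := fun h => (Finset.mem_erase.1 hq).1 h.symm
      rw [norm_mul]
      refine mul_le_mul ?_ (hB.norm_greenExt_le hδ q y) (norm_nonneg _) hε
      simp only [subEnergy, hamiltonian, of_apply, if_neg hne, add_zero, sub_zero, norm_mul,
        Complex.norm_real, Real.norm_eq_abs, abs_of_nonneg hε]
      exact mul_le_of_le_one_right hε (hφ _)
    refine (Finset.sum_le_card_nsmul _ _ _ hterm).trans ?_
    rw [nsmul_eq_mul]
    refine mul_le_mul_of_nonneg_right ?_ (mul_nonneg hε (inv_nonneg.2 hδ.le))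
    exact_mod_cast Finset.card_le_card (Finset.erase_subset x B)
  have h2 : δ ≤ ‖subEnergy (hamiltonian ε φ V) E x x‖ := by
    have h3 : subEnergy (hamiltonian ε φ V) E x x =
        ((V x - E : ℝ) : ℂ) + (ε : ℂ) * φ (x - x) := by
      simp only [subEnergy, hamiltonian, of_apply, if_true]; push_cast; ring
    have h4 : ‖(ε : ℂ) * φ (x - x)‖ ≤ ε := by
      rw [norm_mul, Complex.norm_real, Real.norm_eq_abs, abs_of_nonneg hε]
      exact mul_le_of_le_one_right hε (hφ _)
    have h5 := norm_sub_le_norm_add ((V x - E : ℝ) : ℂ) ((ε : ℂ) * φ (x - x))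
    rw [Complex.norm_real, Real.norm_eq_abs] at h5
    rw [h3]
    linarith
  rw [norm_mul] at h1
  have h6 := (mul_le_mul_of_nonneg_right h2
    (norm_nonneg (greenExt (hamiltonian ε φ V) B E x y))).trans h1
  rw [← le_div_iff₀' hδ, div_eq_mul_inv] at h6
  linarith

/-- A cube on which the potential stays away from the energy is good for weak hopping. -/
theorem good_of_large_potential {φ : Lattice d → ℂ}
    (hsym : ∀ x, φ x = starRingEnd ℂ (φ (-x))) (hφ : ∀ x, ‖φ x‖ ≤ 1) {ε E ρ ρ' κ L : ℝ}
    (hε : 0 ≤ ε) (hκ : 0 ≤ κ) (hρ : 0 ≤ ρ) (hL : 1 ≤ L) {V : Lattice d → ℝ}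
    {x : Lattice d} (hεL : ε * (3 * L) ^ d ≤
      Real.exp (-2 * (Real.log L) ^ ρ' - κ * (Real.log (L + 1)) ^ ρ))
    (hV : ∀ z ∈ cube x L, 2 * Real.exp (-(Real.log L) ^ ρ') ≤ |V z - E|) :
    Good (hamiltonian ε φ V) ρ ρ' κ E x L := by
  set δ := Real.exp (-(Real.log L) ^ ρ')
  have hL0 : 0 ≤ L := by linarith
  have hδ : 0 < δ := Real.exp_pos _
  have hlog : 0 ≤ (Real.log L) ^ ρ' := Real.rpow_nonneg (Real.log_nonneg hL) _
  have hlog' : 0 ≤ (Real.log (L + 1)) ^ ρ := Real.rpow_nonneg (Real.log_nonneg (by linarith)) _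
  have hεB : ε * (cube x L).card ≤
      Real.exp (-2 * (Real.log L) ^ ρ' - κ * (Real.log (L + 1)) ^ ρ) :=
    (mul_le_mul_of_nonneg_left (card_cube_le x hL) hε).trans hεL
  have hexp : Real.exp (-2 * (Real.log L) ^ ρ' - κ * (Real.log (L + 1)) ^ ρ) ≤ δ :=
    Real.exp_le_exp.2 (by linarith [mul_nonneg hκ hlog'])
  have hcard : (1 : ℝ) ≤ (cube x L).card := by
    exact_mod_cast Finset.card_pos.2 ⟨x, self_mem_cube x hL0⟩
  have hB : LowerBounded (hamiltonian ε φ V) δ E (cube x L) :=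
    lowerBounded_of_large_potential hsym hφ hε hδ.le (hεB.trans hexp) hV
  refine ⟨(nonResonant_iff (hamiltonian_isHermitian hsym ε V) hL0).2 hB, ?_⟩
  intro hx y hy hxy
  have hne : x ≠ y := by
    rintro rfl
    rw [sub_self, norm_zero] at hxy
    exact absurd hxy (not_lt.2 (Real.rpow_nonneg hL0 _))
  rw [← greenExt_of_mem hx hy]
  have hεδ : ε ≤ δ := (le_mul_of_one_le_right hε hcard).trans (hεB.trans hexp)
  refine (norm_greenExt_le_of_large_potential hφ hε hδ hεδ hB hx hy hne (hV x hx)).trans ?_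
  have hδinv : δ⁻¹ = Real.exp ((Real.log L) ^ ρ') := by
    rw [← Real.exp_neg, neg_neg]
  calc _ ≤ Real.exp (-2 * (Real.log L) ^ ρ' - κ * (Real.log (L + 1)) ^ ρ) * δ⁻¹ * δ⁻¹ := by
        gcongr
    _ = Real.exp (-κ * (Real.log (L + 1)) ^ ρ) := by
        rw [hδinv, ← Real.exp_add, ← Real.exp_add]
        congr 1
        ring
    _ ≤ _ := by
        refine Real.exp_le_exp.2 ?_
        have h1 : ‖x - y‖ ≤ L := by rw [norm_sub_rev]; exact mem_cube.1 hy
        have h2 : Real.log (‖x - y‖ + 1) ≤ Real.log (L + 1) :=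
          Real.log_le_log (by linarith [norm_nonneg (x - y)]) (by linarith)
        have h3 := Real.rpow_le_rpow
          (Real.log_nonneg (by linarith [norm_nonneg (x - y)])) h2 hρ
        have h4 := mul_le_mul_of_nonneg_left h3 hκ
        linarith

/-! ### Probability estimates at the initial scale and in the induction step -/

section Probability

variable {Ω : Type*} [MeasurableSpace Ω] {P : Measure Ω} {V : Lattice d → Ω → ℝ}

/-- The probability estimate at the initial scale. -/
theorem measure_badPair_initial_le {μ : Measure ℝ} (hV : ∀ x, Measurable (V x))
    (hμ : ∀ x, P.map (V x) = μ) {φ : Lattice d → ℂ} (hsym : ∀ x, φ x = starRingEnd ℂ (φ (-x)))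
    (hφ : ∀ x, ‖φ x‖ ≤ 1) {ε E₀ η ρ ρ' κ L : ℝ} (hε : 0 ≤ ε) (hκ : 0 ≤ κ) (hρ : 0 ≤ ρ)
    (hL : 1 ≤ L) (hεL : ε * (3 * L) ^ d ≤
      Real.exp (-2 * (Real.log L) ^ ρ' - κ * (Real.log (L + 1)) ^ ρ))
    (hη : η ≤ Real.exp (-(Real.log L) ^ ρ')) {s : ℝ≥0∞}
    (hs : ∀ a, μ (Set.Icc a (a + 6 * Real.exp (-(Real.log L) ^ ρ'))) ≤ s) (x y : Lattice d) :
    P {ω | (fun z => V z ω) ∈ badPair ε φ ρ ρ' κ L (Set.Icc (E₀ - η) (E₀ + η)) x y} ≤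
      ENNReal.ofReal ((3 * L) ^ d) * s := by
  set δ := Real.exp (-(Real.log L) ^ ρ')
  -- Badness of the first cube suffices: some potential is within `2 δ` of `E`, hence within `3 δ`
  -- of `E₀`, since `η ≤ δ`.
  have hsub : {ω | (fun z => V z ω) ∈ badPair ε φ ρ ρ' κ L (Set.Icc (E₀ - η) (E₀ + η)) x y} ⊆
      ⋃ z ∈ cube x L, V z ⁻¹' Set.Icc (E₀ - 3 * δ) (E₀ - 3 * δ + 6 * δ) := by
    rintro ω ⟨E, hE, hbad, -⟩
    by_contra hcon
    simp only [Set.mem_iUnion, not_exists, Set.mem_preimage, Set.mem_Icc, not_and, not_le] at hcon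
    refine hbad (good_of_large_potential hsym hφ hε hκ hρ hL hεL fun z hz => ?_)
    have h1 := hcon z hz
    rw [Set.mem_Icc] at hE
    by_contra! h2
    rw [abs_lt] at h2
    have h3 := h1 (by linarith)
    linarith
  refine (measure_mono hsub).trans ((measure_biUnion_finset_le _ _).trans ?_)
  have hterm : ∀ z ∈ cube x L, P (V z ⁻¹' Set.Icc (E₀ - 3 * δ) (E₀ - 3 * δ + 6 * δ)) ≤ s := by
    intro z _
    rw [← Measure.map_apply (hV z) measurableSet_Icc, hμ z]
    exact hs _
  refine (Finset.sum_le_card_nsmul _ _ _ hterm).trans ?_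
  rw [nsmul_eq_mul, ← ENNReal.ofReal_natCast]
  gcongr
  exact card_cube_le x hL

/-- Four separated bad cubes inside a cube, at a common energy, are unlikely. -/
theorem measure_four_bad_le (hV : ∀ x, Measurable (V x)) (hind : iIndepFun V P)
    {φ : Lattice d → ℂ} (hsym : ∀ x, φ x = starRingEnd ℂ (φ (-x))) {ε ρ ρ' κ l L : ℝ} {I : Set ℝ}
    (hl : 0 ≤ l) (hL : 1 ≤ L) {q : ℝ≥0∞}
    (hq : ∀ x y, 2 * l < ‖x - y‖ →
      P {ω | (fun z => V z ω) ∈ badPair ε φ ρ ρ' κ l I x y} ≤ q) (x : Lattice d) :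
    P {ω | ∃ E ∈ I, ∃ z : Fin 4 → Lattice d, (∀ i, z i ∈ cube x L) ∧
        (∀ i j, i ≠ j → 2 * l < ‖z i - z j‖) ∧
        ∀ i, Bad (hamiltonian ε φ fun z => V z ω) ρ ρ' κ E (z i) l} ≤
      ENNReal.ofReal ((3 * L) ^ d) ^ 4 * (q * q) := by
  -- The four cubes are grouped in two pairs and each pair may use its own energy in `I`. The two
  -- events then depend on disjoint sets of sites.
  let F : (Fin 4 → Lattice d) → Set Ω := fun z =>
    {ω | (∀ i j, i ≠ j → 2 * l < ‖z i - z j‖) ∧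
      (fun z => V z ω) ∈ badPair ε φ ρ ρ' κ l I (z 0) (z 1) ∧
      (fun z => V z ω) ∈ badPair ε φ ρ ρ' κ l I (z 2) (z 3)}
  have hsub : {ω | ∃ E ∈ I, ∃ z : Fin 4 → Lattice d, (∀ i, z i ∈ cube x L) ∧
        (∀ i j, i ≠ j → 2 * l < ‖z i - z j‖) ∧
        ∀ i, Bad (hamiltonian ε φ fun z => V z ω) ρ ρ' κ E (z i) l} ⊆
      ⋃ z ∈ Fintype.piFinset fun _ : Fin 4 => cube x L, F z := by
    rintro ω ⟨E, hE, z, hzB, hsep, hbad⟩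
    simp only [Set.mem_iUnion]
    exact ⟨z, Fintype.mem_piFinset.2 hzB, hsep, ⟨E, hE, hbad 0, hbad 1⟩, ⟨E, hE, hbad 2, hbad 3⟩⟩
  have hF : ∀ z ∈ Fintype.piFinset fun _ : Fin 4 => cube x L, P (F z) ≤ q * q := by
    intro z _
    by_cases hsep : ∀ i j, i ≠ j → 2 * l < ‖z i - z j‖
    · have hdisj : Disjoint (cube (z 0) l ∪ cube (z 1) l) (cube (z 2) l ∪ cube (z 3) l) := by
        simp only [Finset.disjoint_union_left, Finset.disjoint_union_right]
        exact ⟨⟨disjoint_cube (hsep 0 2 (by decide)), disjoint_cube (hsep 1 2 (by decide))⟩,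
          disjoint_cube (hsep 0 3 (by decide)), disjoint_cube (hsep 1 3 (by decide))⟩
      have h1 := measure_inter_eq_mul_of_dependsOn hV hind hdisj
        (isOpen_badPair hsym ε ρ ρ' κ hl I (z 0) (z 1))
        (isOpen_badPair hsym ε ρ ρ' κ hl I (z 2) (z 3))
        (fun v v' h => badPair_congr h) (fun v v' h => badPair_congr h)
      refine (measure_mono fun ω hω => hω.2).trans (h1.le.trans ?_)
      exact mul_le_mul' (hq _ _ (hsep 0 1 (by decide))) (hq _ _ (hsep 2 3 (by decide)))
    · have : F z = ∅ := Set.eq_empty_of_forall_notMem fun ω hω => hsep hω.1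
      rw [this, measure_empty]
      exact zero_le
  refine (measure_mono hsub).trans ((measure_biUnion_finset_le _ _).trans ?_)
  refine (Finset.sum_le_card_nsmul _ _ _ hF).trans ?_
  rw [nsmul_eq_mul, Fintype.card_piFinset]
  simp only [Finset.prod_const, Finset.card_univ, Fintype.card_fin, Nat.cast_pow]
  rw [← ENNReal.ofReal_natCast]
  gcongr
  exact card_cube_le x hL

/-- The subregions of `B_L(x)` that have to be non-resonant in the induction step. -/
noncomputable def subregions (l L : ℝ) (x : Lattice d) : Finset (Finset (Lattice d)) :=
  insert (cube x L)
    ((cube x L ×ˢ Finset.Icc 1 4).image fun q => cube q.1 (10 * (q.2 : ℕ) * l) ∩ cube x L)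

theorem subset_of_mem_subregions {l L : ℝ} {x : Lattice d} {Λ : Finset (Lattice d)}
    (h : Λ ∈ subregions l L x) : Λ ⊆ cube x L := by
  rw [subregions, Finset.mem_insert, Finset.mem_image] at h
  rcases h with rfl | ⟨q, -, rfl⟩
  · exact subset_rfl
  · exact Finset.inter_subset_right

theorem card_subregions_le (l : ℝ) {L : ℝ} (hL : 0 ≤ L) (x : Lattice d) :
    (subregions l L x).card ≤ 5 * (cube x L).card := by
  have h1 : (subregions l L x).card ≤ (cube x L ×ˢ Finset.Icc 1 4).card + 1 :=
    (Finset.card_insert_le _ _).trans (Nat.add_le_add_right Finset.card_image_le 1)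
  have h2 : 0 < (cube x L).card := Finset.card_pos.2 ⟨x, self_mem_cube x hL⟩
  rw [Finset.card_product, Nat.card_Icc] at h1
  omega

/-- Subregions of separated cubes are disjoint, so the Wegner estimate applies to each of the at
most `(5 n)²` pairs and costs `n² s` per pair. -/
theorem measure_resonant_subregions_le [IsProbabilityMeasure P] {μ : Measure ℝ}
    (hV : ∀ x, Measurable (V x)) (hμ : ∀ x, P.map (V x) = μ) (hind : iIndepFun V P)
    {φ : Lattice d → ℂ} (hsym : ∀ x, φ x = starRingEnd ℂ (φ (-x))) (ε : ℝ) {δ l L : ℝ}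
    (hδ : 0 < δ) (hL : 1 ≤ L) {s : ℝ≥0∞}
    (hs : ∀ a, μ (Set.Icc a (a + 4 * δ * (3 * L) ^ d)) ≤ s) {x y : Lattice d}
    (hxy : 2 * L < ‖x - y‖) :
    P {ω | ∃ E, (∃ Λ ∈ subregions l L x,
          ¬ LowerBounded (hamiltonian ε φ fun z => V z ω) δ E Λ) ∧
        ∃ Λ' ∈ subregions l L y, ¬ LowerBounded (hamiltonian ε φ fun z => V z ω) δ E Λ'} ≤
      25 * (ENNReal.ofReal ((3 * L) ^ d) ^ 4 * s) := by
  set n := ENNReal.ofReal ((3 * L) ^ d)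
  have hL0 : 0 ≤ L := by linarith
  have hcard : ∀ x : Lattice d, ((cube x L).card : ℝ≥0∞) ≤ n := fun x => by
    rw [← ENNReal.ofReal_natCast]
    exact ENNReal.ofReal_le_ofReal (card_cube_le x hL)
  have hcardΛ : ∀ (x : Lattice d), ∀ Λ ∈ subregions l L x, (Λ.card : ℝ≥0∞) ≤ n := fun x Λ h =>
    le_trans (by exact_mod_cast Finset.card_le_card (subset_of_mem_subregions h)) (hcard x)
  have hcardS : ∀ x : Lattice d, ((subregions l L x).card : ℝ≥0∞) ≤ 5 * n := fun x =>
    calc ((subregions l L x).card : ℝ≥0∞) ≤ ((5 * (cube x L).card : ℕ) : ℝ≥0∞) := by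
          exact_mod_cast card_subregions_le l hL0 x
      _ = 5 * ((cube x L).card : ℝ≥0∞) := by push_cast; rfl
      _ ≤ 5 * n := by gcongr; exact hcard x
  have hsub : {ω | ∃ E, (∃ Λ ∈ subregions l L x,
          ¬ LowerBounded (hamiltonian ε φ fun z => V z ω) δ E Λ) ∧
        ∃ Λ' ∈ subregions l L y, ¬ LowerBounded (hamiltonian ε φ fun z => V z ω) δ E Λ'} ⊆
      ⋃ q ∈ subregions l L x ×ˢ subregions l L y,
        {ω | ∃ E, ¬ LowerBounded (hamiltonian ε φ fun z => V z ω) δ E q.1 ∧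
          ¬ LowerBounded (hamiltonian ε φ fun z => V z ω) δ E q.2} := by
    rintro ω ⟨E, ⟨Λ, hΛ, h1⟩, Λ', hΛ', h2⟩
    simp only [Set.mem_iUnion]
    exact ⟨(Λ, Λ'), Finset.mem_product.2 ⟨hΛ, hΛ'⟩, E, h1, h2⟩
  have hterm : ∀ q ∈ subregions l L x ×ˢ subregions l L y,
      P {ω | ∃ E, ¬ LowerBounded (hamiltonian ε φ fun z => V z ω) δ E q.1 ∧
          ¬ LowerBounded (hamiltonian ε φ fun z => V z ω) δ E q.2} ≤ n * (n * s) := by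
    intro q hq
    rw [Finset.mem_product] at hq
    have hdisj : Disjoint q.1 q.2 := (disjoint_cube hxy).mono (subset_of_mem_subregions hq.1)
      (subset_of_mem_subregions hq.2)
    refine (measure_common_resonance_le hV hμ hind hsym ε hdisj hδ ?_ hs).trans ?_
    · have h1 : (q.1.card : ℝ) ≤ (3 * L) ^ d :=
        le_trans (by exact_mod_cast Finset.card_le_card (subset_of_mem_subregions hq.1))
          (card_cube_le x hL)
      exact mul_le_mul_of_nonneg_left h1 (by linarith)
    · exact mul_le_mul' (hcardΛ x _ hq.1) (mul_le_mul_left (hcardΛ y _ hq.2) s)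
  refine (measure_mono hsub).trans ((measure_biUnion_finset_le _ _).trans ?_)
  refine (Finset.sum_le_card_nsmul _ _ _ hterm).trans ?_
  rw [nsmul_eq_mul, Finset.card_product, Nat.cast_mul]
  calc _ ≤ (5 * n * (5 * n)) * (n * (n * s)) :=
        mul_le_mul_left (mul_le_mul' (hcardS x) (hcardS y)) _
    _ = _ := by ring

/-- The probabilistic induction step from the scale `l` to the scale `L`. -/
theorem measure_badPair_step_le [IsProbabilityMeasure P] {μ : Measure ℝ}
    (hV : ∀ x, Measurable (V x)) (hμ : ∀ x, P.map (V x) = μ) (hind : iIndepFun V P)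
    {φ : Lattice d → ℂ} (hsym : ∀ x, φ x = starRingEnd ℂ (φ (-x))) {ε ρ ρ' κ κ' l L : ℝ}
    {I : Set ℝ} (hl : 0 ≤ l) (hL : 1 ≤ L)
    (hgood : ∀ (E : ℝ) (v : Lattice d → ℝ) (x : Lattice d),
      LowerBounded (hamiltonian ε φ v) (Real.exp (-(Real.log L) ^ ρ')) E (cube x L) →
      (∀ w ∈ cube x L, ∀ k : ℕ, 1 ≤ k → k ≤ 4 →
        LowerBounded (hamiltonian ε φ v) (Real.exp (-(Real.log L) ^ ρ')) E
          (cube w (10 * k * l) ∩ cube x L)) →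
      (∀ z : Fin 4 → Lattice d, (∀ i, z i ∈ cube x L) → (∀ i j, i ≠ j → 2 * l < ‖z i - z j‖) →
        ∃ i, Good (hamiltonian ε φ v) ρ ρ' κ E (z i) l) →
      Good (hamiltonian ε φ v) ρ ρ' κ' E x L)
    {q s : ℝ≥0∞}
    (hq : ∀ x y, 2 * l < ‖x - y‖ →
      P {ω | (fun z => V z ω) ∈ badPair ε φ ρ ρ' κ l I x y} ≤ q)
    (hs : ∀ a, μ (Set.Icc a (a + 4 * Real.exp (-(Real.log L) ^ ρ') * (3 * L) ^ d)) ≤ s)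
    {x y : Lattice d} (hxy : 2 * L < ‖x - y‖) :
    P {ω | (fun z => V z ω) ∈ badPair ε φ ρ ρ' κ' L I x y} ≤
      25 * (ENNReal.ofReal ((3 * L) ^ d) ^ 4 * s) +
        2 * (ENNReal.ofReal ((3 * L) ^ d) ^ 4 * (q * q)) := by
  set δ := Real.exp (-(Real.log L) ^ ρ')
  let W : Set Ω := {ω | ∃ E, (∃ Λ ∈ subregions l L x,
          ¬ LowerBounded (hamiltonian ε φ fun z => V z ω) δ E Λ) ∧
        ∃ Λ' ∈ subregions l L y, ¬ LowerBounded (hamiltonian ε φ fun z => V z ω) δ E Λ'}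
  let F : Lattice d → Set Ω := fun x =>
    {ω | ∃ E ∈ I, ∃ z : Fin 4 → Lattice d, (∀ i, z i ∈ cube x L) ∧
        (∀ i j, i ≠ j → 2 * l < ‖z i - z j‖) ∧
        ∀ i, Bad (hamiltonian ε φ fun z => V z ω) ρ ρ' κ E (z i) l}
  have hkey : ∀ (ω : Ω) (E : ℝ) (x : Lattice d), E ∈ I →
      Bad (hamiltonian ε φ fun z => V z ω) ρ ρ' κ' E x L → ω ∉ F x →
      ∃ Λ ∈ subregions l L x, ¬ LowerBounded (hamiltonian ε φ fun z => V z ω) δ E Λ := by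
    intro ω E x hE hbad hF
    by_contra! hcon
    refine hbad (hgood E _ x (hcon _ (Finset.mem_insert_self _ _)) (fun w hw k hk1 hk4 => ?_)
      fun z hz hsep => ?_)
    · refine hcon _ (Finset.mem_insert_of_mem (Finset.mem_image.2 ⟨(w, k), ?_, rfl⟩))
      exact Finset.mem_product.2 ⟨hw, Finset.mem_Icc.2 ⟨hk1, hk4⟩⟩
    · by_contra! hall
      exact hF ⟨E, hE, z, hz, hsep, hall⟩
  -- If neither cube has four separated bad subcubes, both are bad through a resonance, and at the
  -- same energy.
  have hsub : {ω | (fun z => V z ω) ∈ badPair ε φ ρ ρ' κ' L I x y} ⊆ W ∪ (F x ∪ F y) := by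
    rintro ω ⟨E, hE, hx, hy⟩
    by_cases h1 : ω ∈ F x
    · exact Or.inr (Or.inl h1)
    by_cases h2 : ω ∈ F y
    · exact Or.inr (Or.inr h2)
    exact Or.inl ⟨E, hkey ω E x hE hx h1, hkey ω E y hE hy h2⟩
  refine (measure_mono hsub).trans ((measure_union_le _ _).trans (add_le_add ?_ ?_))
  · exact measure_resonant_subregions_le hV hμ hind hsym ε (Real.exp_pos _) hL hs hxy
  · rw [two_mul]
    exact (measure_union_le _ _).trans (add_le_add
      (measure_four_bad_le hV hind hsym hl hL hq x) (measure_four_bad_le hV hind hsym hl hL hq y))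

end Probability

/-! ### Thresholds for the scales -/

/-- Powers of `log L` are `o(L)`. Hence the single choice `exp(-L₀)` for `ε₀` and `η` works for all
`ρ`, `ρ'` and `κ₀`, which only enter the threshold for `L₀`. -/
theorem eventually_exp_neg_mul_le (d : ℕ) (κ ρ ρ' : ℝ) (hκ : 0 ≤ κ) (hρ : 0 ≤ ρ) :
    ∀ᶠ L : ℝ in atTop, Real.exp (-L) * (3 * L) ^ d ≤
      Real.exp (-2 * (Real.log L) ^ ρ' - κ * (Real.log (L + 1)) ^ ρ) := by
  have key : ∀ r C : ℝ, ∀ᶠ L : ℝ in atTop, C * (Real.log L) ^ r ≤ 1 / 3 * L := by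
    intro r C
    have h := ((isLittleO_log_rpow_rpow_atTop r (s := 1) one_pos).const_mul_left C).bound
      (c := 1 / 3) (by norm_num)
    filter_upwards [h, eventually_gt_atTop 0] with L hL hL0
    rw [Real.rpow_one, Real.norm_eq_abs, Real.norm_eq_abs, abs_of_pos hL0] at hL
    exact (le_abs_self _).trans hL
  filter_upwards [key 1 (2 * d), key ρ' 2, key ρ (κ * 2 ^ ρ), eventually_ge_atTop 3]
    with L h1 h2 h3 hL
  have hL0 : 0 < L := by linarith
  have hpow : (3 * L) ^ d ≤ Real.exp (2 * d * Real.log L) := by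
    have h4 : Real.exp (2 * d * Real.log L) = (L ^ 2) ^ d := by
      rw [← pow_mul, ← Real.rpow_natCast, Real.rpow_def_of_pos hL0]
      congr 1
      push_cast
      ring
    rw [h4]
    exact pow_le_pow_left₀ (by linarith) (by nlinarith) d
  have hlog : (Real.log (L + 1)) ^ ρ ≤ 2 ^ ρ * (Real.log L) ^ ρ := by
    rw [← Real.mul_rpow (by norm_num) (Real.log_nonneg (by linarith))]
    refine Real.rpow_le_rpow (Real.log_nonneg (by linarith)) ?_ hρ
    have h5 : Real.log (L ^ 2) = 2 * Real.log L := by rw [Real.log_pow]; norm_num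
    rw [← h5]
    exact Real.log_le_log (by linarith) (by nlinarith)
  have h6 := mul_le_mul_of_nonneg_left hlog hκ
  rw [Real.rpow_one] at h1
  calc _ ≤ Real.exp (-L) * Real.exp (2 * d * Real.log L) :=
        mul_le_mul_of_nonneg_left hpow (Real.exp_pos _).le
    _ ≤ _ := by
        rw [← Real.exp_add]
        exact Real.exp_le_exp.2 (by linarith)

/-- Superpolynomial smallness of the Hölder modulus at the resonance threshold. -/
theorem eventually_holder_modulus_le (d k : ℕ) {ρ' lam : ℝ} (hρ' : 1 < ρ') (hlam : 0 < lam)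
    (C c e : ℝ) (hc : 0 < c) :
    ∀ᶠ L : ℝ in atTop, C * ((3 * L) ^ d) ^ k *
      (c * Real.exp (-(Real.log L) ^ ρ') * (3 * L) ^ d) ^ lam ≤ L ^ (-e) := by
  filter_upwards [eventually_mul_rpow_mul_exp_le_one
    (C * 3 ^ (d * k) * (c * 3 ^ d) ^ lam) ((d * k : ℕ) + d * lam + e) hlam hρ',
    eventually_gt_atTop 0] with L h hL
  rw [Real.rpow_neg hL.le, ← one_div, le_div_iff₀ (Real.rpow_pos_of_pos hL _)]
  refine le_of_eq_of_le ?_ h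
  have h1 : c * Real.exp (-(Real.log L) ^ ρ') * (3 * L) ^ d =
      (c * 3 ^ d) * L ^ (d : ℝ) * Real.exp (-(Real.log L) ^ ρ') := by
    rw [mul_pow, Real.rpow_natCast]; ring
  have h2 : Real.exp (-(Real.log L) ^ ρ') ^ lam = Real.exp (-lam * (Real.log L) ^ ρ') := by
    rw [← Real.exp_mul]; congr 1; ring
  rw [h1, Real.mul_rpow (by positivity) (Real.exp_pos _).le, Real.mul_rpow (by positivity)
    (by positivity), ← Real.rpow_mul hL.le, h2, ← pow_mul, mul_pow, Real.rpow_add hL,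
    Real.rpow_add hL, Real.rpow_natCast]
  ring

theorem eventually_threshold_le (d : ℕ) {ρ' t : ℝ} (hρ' : 1 < ρ') (ht : 0 < t) (c : ℝ) :
    ∀ᶠ L : ℝ in atTop, c * Real.exp (-(Real.log L) ^ ρ') * (3 * L) ^ d ≤ t := by
  filter_upwards [eventually_mul_rpow_mul_exp_le_one (c * 3 ^ d / t) (d : ℝ) one_pos hρ']
    with L h
  rw [Real.rpow_natCast, neg_one_mul] at h
  rw [← div_le_one ht]
  refine le_of_eq_of_le ?_ h
  rw [mul_pow]
  ring

theorem badPair_mono {d : ℕ} {ε : ℝ} {φ : Lattice d → ℂ} {ρ ρ' κ κ' L : ℝ} {I : Set ℝ}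
    {x y : Lattice d} (h : κ ≤ κ') :
    badPair ε φ ρ ρ' κ L I x y ⊆ badPair ε φ ρ ρ' κ' L I x y := by
  rintro v ⟨E, hE, hx, hy⟩
  exact ⟨E, hE, fun hg => hx (hg.mono h), fun hg => hy (hg.mono h)⟩

/-- The union bound in the induction step closes. -/
theorem step_bound_le (d : ℕ) {p α l L b : ℝ} (hα : 0 < α) (hp : 0 < p) (hl : 0 < l) (hL : 0 < L)
    (hLl : L ≤ l ^ α) (hb0 : 0 ≤ b) (hb : 50 * b * ((3 * L) ^ d) ^ 4 ≤ L ^ (-(2 * p)))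
    (hpow : 4 * (3 ^ d) ^ 4 * L ^ (4 * (d : ℝ) + -(4 * p / α) + 2 * p) ≤ 1) :
    25 * (ENNReal.ofReal ((3 * L) ^ d) ^ 4 * ENNReal.ofReal b) +
      2 * (ENNReal.ofReal ((3 * L) ^ d) ^ 4 *
        (ENNReal.ofReal (l ^ (-(2 * p))) * ENNReal.ofReal (l ^ (-(2 * p))))) ≤
      ENNReal.ofReal (L ^ (-(2 * p))) := by
  have hl' : l ^ (-(2 * p)) * l ^ (-(2 * p)) ≤ L ^ (-(4 * p / α)) := by
    have h1 : l ^ (-(2 * p)) * l ^ (-(2 * p)) = (l ^ α) ^ (-(4 * p / α)) := by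
      rw [← Real.rpow_add hl, ← Real.rpow_mul hl.le]
      congr 1
      field_simp
      ring
    rw [h1]
    exact Real.rpow_le_rpow_of_nonpos hL hLl (neg_nonpos.2 (by positivity))
  have h2 : 4 * (((3 * L) ^ d) ^ 4 * L ^ (-(4 * p / α))) ≤ L ^ (-(2 * p)) := by
    rw [Real.rpow_neg hL.le (2 * p), ← one_div, le_div_iff₀ (Real.rpow_pos_of_pos hL _)]
    refine le_of_eq_of_le ?_ hpow
    have h3 : L ^ (4 * (d : ℝ)) = (L ^ d) ^ 4 := by
      rw [← pow_mul, ← Real.rpow_natCast]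
      congr 1
      push_cast
      ring
    rw [Real.rpow_add hL, Real.rpow_add hL, mul_pow, mul_pow, h3]
    ring
  have h3 : ((3 * L) ^ d) ^ 4 * (l ^ (-(2 * p)) * l ^ (-(2 * p))) ≤
      ((3 * L) ^ d) ^ 4 * L ^ (-(4 * p / α)) := mul_le_mul_of_nonneg_left hl' (by positivity)
  have e25 : (25 : ℝ≥0∞) = ENNReal.ofReal 25 := by norm_num
  have e2 : (2 : ℝ≥0∞) = ENNReal.ofReal 2 := by norm_num
  rw [e25, e2, ← ENNReal.ofReal_pow (by positivity), ← ENNReal.ofReal_mul (by positivity),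
    ← ENNReal.ofReal_mul (by positivity), ← ENNReal.ofReal_mul (by positivity),
    ← ENNReal.ofReal_mul (by positivity), ← ENNReal.ofReal_mul (by positivity),
    ← ENNReal.ofReal_add (by positivity) (by positivity)]
  exact ENNReal.ofReal_le_ofReal (by linarith)

end LongRangeMSA

/-! ### Choice of parameters and induction on scales -/

theorem theorem5p4 (d : ℕ) (lam β : ℝ) (hlam : 0 < lam) (hβ : 0 < β) :
    -- `η` depends only on `d`, `lam`, `β` and `L₀`
    ∃ η : ℝ → ℝ, (∀ L₀, 0 < η L₀) ∧
    ∀ (μ : Measure ℝ) [IsProbabilityMeasure μ], IsHolder lam μ →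
    ENNReal.ofReal β < holderD lam μ →
    ∀ φ : Lattice d → ℂ, (∀ x, φ x = starRingEnd ℂ (φ (-x))) →
    -- `ε₀` depends only on `d`, `lam`, `β`, `μ`, `φ` and `L₀`
    ∃ ε₀ : ℝ → ℝ, (∀ L₀, 0 < ε₀ L₀) ∧
    ∀ M γ ρ ρ' κ₀ κinf p α : ℝ,
    0 < M → μ.support ⊆ Set.Icc (-M) M →
    0 < γ → 1 < ρ → (∀ x, ‖φ x‖ ≤ Real.exp (-γ * (Real.log (‖x‖ + 1)) ^ ρ)) →
    1 < ρ' → ρ' < ρ →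
    0 < κ₀ → κ₀ ≤ γ / 5 → 0 < κinf → κinf < κ₀ →
    5 * (d : ℝ) < p → 5 / 4 < α → α < 2 * p / (p + 2 * d) →
    -- the lower bound for `L₀` depends on all of the above, but not on `E₀`, `ε` or `V`
    ∃ Lmin : ℝ, 0 < Lmin ∧ ∀ L₀ : ℝ, Lmin ≤ L₀ →
    ∀ E₀ : ℝ, |E₀| ≤ 2 * (‖hoppingOp φ‖ + M) →
    ∀ ε : ℝ, 0 < ε → ε < ε₀ L₀ →
    ∀ (Ω : Type*) [MeasurableSpace Ω] (P : Measure Ω) [IsProbabilityMeasure P]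
      (V : Lattice d → Ω → ℝ),
    (∀ x, Measurable (V x)) → (∀ x, P.map (V x) = μ) → iIndepFun V P →
    ∀ (s : ℕ) (x y : Lattice d), 2 * scale α L₀ s < ‖x - y‖ →
      P {ω | ∃ E ∈ Set.Icc (E₀ - η L₀) (E₀ + η L₀),
          Bad (hamiltonian ε φ fun z => V z ω) ρ ρ' κinf E x (scale α L₀ s) ∧
          Bad (hamiltonian ε φ fun z => V z ω) ρ ρ' κinf E y (scale α L₀ s)} ≤
        ENNReal.ofReal (scale α L₀ s ^ (-(2 * p))) := by
  refine ⟨fun L => Real.exp (-L), fun L => Real.exp_pos _, ?_⟩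
  intro μ _ _ hμβ φ hsym
  refine ⟨fun L => Real.exp (-L), fun L => Real.exp_pos _, ?_⟩
  intro M γ ρ ρ' κ₀ κinf p α _ _ hγ hρ hφ hρ' hρ'ρ hκ₀ hκγ hκinf hκ hp hα1 hα2
  obtain ⟨t, ht, hholder⟩ := exists_measure_Icc_le hβ hμβ
  have hp0 : 0 < p := lt_of_le_of_lt (by positivity) hp
  have hα0 : 0 < α := by linarith
  have hd0 : (0 : ℝ) ≤ d := Nat.cast_nonneg d
  have hα2' : α * (p + 2 * d) < 2 * p := (lt_div_iff₀ (by linarith)).1 hα2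
  have hα_le : α ≤ 2 := by
    by_contra! h
    nlinarith
  set σ : ℝ := min 1 (ρ - ρ') / 2
  have hmin : 0 < min 1 (ρ - ρ') := lt_min one_pos (by linarith)
  have hσ0 : 0 < σ := half_pos hmin
  have hσ1 : σ < 1 := (half_lt_self hmin).trans_le (min_le_left _ _)
  have hσρ : σ < ρ - ρ' := (half_lt_self hmin).trans_le (min_le_right _ _)
  -- An exponent strictly between `5/4` and `α` absorbs the integer part: `2 l^a ≤ l^α` gives `l^a ≤
  -- ⌊l^α⌋`.
  set a : ℝ := (α + 5 / 4) / 2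
  have ha : 5 / 4 < a := by simp only [a]; linarith
  have haα : a < α := by simp only [a]; linarith
  -- Equivalent to `α < 2p/(p + 2d)`: the positions of four bad cubes cost `L^{4d}`, while the
  -- squared bound gains `l^{-4p} ≤ L^{-4p/α}`.
  have hexp : 4 * (d : ℝ) + -(4 * p / α) + 2 * p < 0 := by
    have : 2 * p + 4 * d < 4 * p / α := by
      rw [lt_div_iff₀ hα0]; linarith
    linarith
  have hgoodstep := eventually_good_of_subcubes hsym hρ hφ hρ' hρ'ρ hκinf hκ
    (show κ₀ ≤ γ by linarith) hσ0 hσ1 hσρ ha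
  have hall := hgoodstep.and <| (eventually_mul_rpow_le_mul_rpow haα 2 one_pos).and <|
    (eventually_exp_neg_mul_le d κ₀ ρ ρ' hκ₀.le (by linarith)).and <|
    (eventually_holder_modulus_le d 4 hρ' hlam (50 * β⁻¹) 4 (2 * p) (by norm_num)).and <|
    (eventually_holder_modulus_le d 1 hρ' hlam β⁻¹ 6 (2 * p) (by norm_num)).and <|
    (eventually_threshold_le d hρ' ht 6).and <|
    (eventually_mul_rpow_le_one (4 * (3 ^ d) ^ 4) hexp).and <|
    (Real.tendsto_log_atTop.eventually (Filter.eventually_ge_atTop 1)).and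
      (Filter.eventually_ge_atTop 2)
  obtain ⟨L₁, hL₁⟩ := Filter.eventually_atTop.1 hall
  refine ⟨max L₁ 2, by positivity, ?_⟩
  intro L₀ hL₀ E₀ _ ε hε hεL Ω _ P _ V hV hμ hind
  have hnext : ∀ l, L₁ ≤ l → l ^ a ≤ ⌊l ^ α⌋ ∧ (⌊l ^ α⌋ : ℝ) ≤ l ^ α ∧ l ≤ ⌊l ^ α⌋ := by
    intro l hl
    obtain ⟨-, h1, -, -, -, -, -, -, hl2⟩ := hL₁ l hl
    have h2 : l ≤ l ^ a := by
      conv_lhs => rw [← Real.rpow_one l]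
      exact Real.rpow_le_rpow_of_exponent_le (by linarith) (by linarith)
    have h3 := Int.sub_one_lt_floor (l ^ α)
    have h4 : l ^ a ≤ ⌊l ^ α⌋ := by linarith
    exact ⟨h4, Int.floor_le _, h2.trans h4⟩
  -- The scales never decrease, so the asymptotic conditions collected in `hall` hold at each of
  -- them.
  have hscale : ∀ s, L₁ ≤ scale α L₀ s := by
    intro s
    induction s with
    | zero => exact (le_max_left _ _).trans hL₀
    | succ s ih => exact ih.trans (hnext _ ih).2.2
  set I := Set.Icc (E₀ - Real.exp (-L₀)) (E₀ + Real.exp (-L₀))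
  -- The induction hypothesis uses the larger, scale-dependent rate; the energy window `I` is the
  -- same at all scales.
  have hmain : ∀ (s : ℕ) (x y : Lattice d), 2 * scale α L₀ s < ‖x - y‖ →
      P {ω | (fun z => V z ω) ∈ badPair ε φ ρ ρ' (rate κ₀ κinf σ (scale α L₀ s))
        (scale α L₀ s) I x y} ≤ ENNReal.ofReal (scale α L₀ s ^ (-(2 * p))) := by
    intro s
    induction s with
    | zero =>
      intro x y _
      obtain ⟨-, -, hinit, -, hprob, hthr, -, hlog, hL2⟩ := hL₁ _ (hscale 0)
      simp only [scale] at hinit hprob hthr hlog hL2 ⊢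
      have hN : 1 ≤ (3 * L₀) ^ d := one_le_pow₀ (by linarith)
      have hδ0 := Real.exp_pos (-(Real.log L₀) ^ ρ')
      have hrhs : Real.exp (-2 * (Real.log L₀) ^ ρ' - κ₀ * (Real.log (L₀ + 1)) ^ ρ) ≤
          Real.exp (-(Real.log L₀) ^ ρ') := by
        have h1 : 0 ≤ (Real.log L₀) ^ ρ' := Real.rpow_nonneg (by linarith) _
        have h2 : 0 ≤ κ₀ * (Real.log (L₀ + 1)) ^ ρ :=
          mul_nonneg hκ₀.le (Real.rpow_nonneg (Real.log_nonneg (by linarith)) _)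
        exact Real.exp_le_exp.2 (by linarith)
      have h6 : 6 * Real.exp (-(Real.log L₀) ^ ρ') ≤
          6 * Real.exp (-(Real.log L₀) ^ ρ') * (3 * L₀) ^ d :=
        le_mul_of_one_le_right (by positivity) hN
      have hbound := measure_badPair_initial_le (E₀ := E₀) (η := Real.exp (-L₀)) hV hμ hsym
        (norm_le_one_of_decay hγ.le hφ) hε.le hκ₀.le (by linarith) (by linarith)
        ((mul_le_mul_of_nonneg_right hεL.le (by positivity)).trans hinit)
        ((le_mul_of_one_le_right (Real.exp_pos _).le hN).trans (hinit.trans hrhs))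
        (fun b => hholder b _ (by positivity) (h6.trans hthr)) x y
      refine le_trans (measure_mono fun ω hω => ?_) (hbound.trans ?_)
      · exact badPair_mono (rate_le hκ.le hσ0.le hlog) hω
      rw [← ENNReal.ofReal_mul (by positivity)]
      refine ENNReal.ofReal_le_ofReal (le_trans ?_ hprob)
      have h7 := Real.rpow_le_rpow (by positivity) h6 hlam.le
      have h8 := mul_le_mul_of_nonneg_left h7 (show 0 ≤ β⁻¹ * (3 * L₀) ^ d by positivity)
      rw [pow_one]
      linarith
    | succ s ih =>
      intro x y hxy
      have hsl := hscale s
      have hsL := hscale (s + 1)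
      rw [scale] at hsL hxy ⊢
      set l := scale α L₀ s
      set L : ℝ := ((⌊l ^ α⌋ : ℤ) : ℝ)
      obtain ⟨hgood, -, -, -, -, -, -, -, hl2⟩ := hL₁ _ hsl
      obtain ⟨-, -, -, hprob, -, hthr, hpow, -, hL2⟩ := hL₁ _ hsL
      obtain ⟨hla, hLα, hlL⟩ := hnext l hsl
      have hl0 : 0 < l := by linarith
      have hL0 : 0 < L := by linarith
      have hLl : L ≤ l ^ (2 : ℝ) :=
        hLα.trans (Real.rpow_le_rpow_of_exponent_le (by linarith) hα_le)
      have hε1 : ε ≤ 1 := by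
        have : 0 ≤ L₀ := (by norm_num : (0 : ℝ) ≤ 2).trans ((le_max_right _ _).trans hL₀)
        exact hεL.le.trans (Real.exp_le_one_iff.2 (by linarith))
      have hδ0 := Real.exp_pos (-(Real.log L) ^ ρ')
      have h46 : 4 * Real.exp (-(Real.log L) ^ ρ') * (3 * L) ^ d ≤ t := by
        refine le_trans ?_ hthr
        gcongr
        norm_num
      refine (measure_badPair_step_le (q := ENNReal.ofReal (l ^ (-(2 * p))))
        (s := ENNReal.ofReal (β⁻¹ * (4 * Real.exp (-(Real.log L) ^ ρ') * (3 * L) ^ d) ^ lam))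
        hV hμ hind hsym hl0.le (by linarith)
        (fun E v x => hgood L hla hLl ε E v x hε.le hε1) ih
        (fun b => hholder b _ (by positivity) h46) hxy).trans ?_
      refine step_bound_le d hα0 hp0 hl0 hL0 hLα (by positivity) (le_of_eq_of_le ?_ hprob) hpow
      ring
  intro s x y hxy
  have hL2 : 2 ≤ scale α L₀ s := (hL₁ _ (hscale s)).2.2.2.2.2.2.2.2
  refine le_trans (measure_mono fun ω hω => ?_) (hmain s x y hxy)
  exact badPair_mono (le_rate hκ.le (by linarith)) hω
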